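/- Let $n\ge 3$ and $p>1$. Let $u,v\in C^2(\mathbb R^n)$ be a positive classical solution of $$-\Delta u=\sqrt p\,u^{p-1}v,\qquad -\Delta v=\sqrt p\,u^{p},\qquad u>0,\ v>0\quad\text{in }\mathbb R^n,$$ with $\inf_{\mathbb R^n}v=0$ (so that $v$ contains no positive additive constant; this holds in particular if $v$ is a constant multiple of the Newtonian potential $\int_{\mathbb R^n}u^p(y)|x-y|^{2-n}\,dy$). If $u\in L^{n(p-1)/2}(\mathbb R^n)$, then $u^pv\in L^1(\mathbb R^n)$ and $u\in\mathcal D^{1,2}(\mathbb R^n)$, that is, $u\in L^{2n/(n-2)}(\mathbb R^n)$ and $u$ has a weak gradient in $L^2(\mathbb R^n)$. Moreover, $|\nabla u|^2$ and $|\nabla v|^2$ are integrable and $$\int_{\mathbb R^n}|\nabla u|^2\,dx=\int_{\mathbb R^n}|\nabla v|^2\,dx=\sqrt p\int_{\mathbb R^n}u^pv\,dx .$$ -/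

import Mathlib

open MeasureTheory InnerProductSpace
open scoped Gradient Laplacian ContDiff

/-- The system `-Δu = √p u^{p-1} v`, `-Δv = √p u^p`, `u, v > 0`, solved on `ℝⁿ` in the
classical sense: `u` and `v` are of class `C²` and the equations hold at every point. -/
structure IsClassicalSolution (n : ℕ) (p : ℝ) (u v : EuclideanSpace ℝ (Fin n) → ℝ) : Prop where
  contDiff_u : ContDiff ℝ 2 u
  contDiff_v : ContDiff ℝ 2 v
  pos_u : ∀ x, 0 < u x
  pos_v : ∀ x, 0 < v x
  eq_u : ∀ x, -(Δ u) x = √p * u x ^ (p - 1) * v x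
  eq_v : ∀ x, -(Δ v) x = √p * u x ^ p

/-- `g` is the weak (distributional) gradient of `u` on `ℝⁿ`:
`∫ u ∂ₑφ = -∫ ⟨g, e⟩ φ` for all test functions `φ ∈ C_c^∞` and all directions `e`.
It is used only for `u` and `g` that are locally integrable. -/
def IsWeakGradient {n : ℕ} (u : EuclideanSpace ℝ (Fin n) → ℝ)
    (g : EuclideanSpace ℝ (Fin n) → EuclideanSpace ℝ (Fin n)) : Prop :=
  ∀ φ : EuclideanSpace ℝ (Fin n) → ℝ, ContDiff ℝ ∞ φ → HasCompactSupport φ →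
    ∀ e : EuclideanSpace ℝ (Fin n),
      ∫ x, u x * fderiv ℝ φ x e = -∫ x, inner ℝ (g x) e * φ x

/-- Membership in the homogeneous Sobolev space `𝒟^{1,2}(ℝⁿ)`, `n ≥ 3`: the functions in
`L^{2*}`, `2* = 2n/(n-2)`, that have a weak gradient in `L²`. -/
def MemHomSobolev {n : ℕ} (u : EuclideanSpace ℝ (Fin n) → ℝ) : Prop :=
  MemLp u (ENNReal.ofReal (2 * (n : ℝ) / ((n : ℝ) - 2))) volume ∧
    ∃ g : EuclideanSpace ℝ (Fin n) → EuclideanSpace ℝ (Fin n),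
      MemLp g 2 volume ∧ IsWeakGradient u g

/-! The system collapses to one equation. The difference `w = v - u` satisfies `Δ w = √p u^(p-1) w`,
so `√(1 + w²) - 1` is subharmonic, and it is at most `u + v`. Both components are positive and
superharmonic with infimum zero (for `u` because a function in `L^q` on a space of infinite measure
is not bounded below by a positive constant). Averages over large balls then force `w = 0`; this is
`eq_of_laplacian_sub_eq_mul`.

For `-Δ u = √p u^p` the norm in `L^(n(p-1)/2)` is scale invariant. A point-picking argument gives
ε-regularity (`exists_pos_forall_rpow_mul_le`). Applied on balls of radius `|x|/2`, where the tail
of the integral is small, it yields `u = o(|x|^(-2/(p-1)))`. So `u` solves `-Δ u = V u` with `V =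
o(|x|^(-2))`, and comparison with powers of `1 + |x|²` improves the decay to `O(|x|^(-2b))` for
every `2b < n - 2` (`exists_forall_le_one_add_norm_sq_rpow_of_integrable`).

The choice `2b = 3(n-2)/4` makes `u^(2n/(n-2))`, `u^(p+1)` and `u² / (1 + |x|²)` integrable. The
last of these makes the cutoff error vanish when the equation is tested with `u`, which gives the
energy identity. -/

/-! ### Pointwise calculus of the Laplacian -/

section Calculus

variable {E : Type*} [NormedAddCommGroup E] [InnerProductSpace ℝ E]

theorem ContDiff.differentiable_fderiv_apply {f : E → ℝ} (hf : ContDiff ℝ 2 f) (e : E) :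
    Differentiable ℝ (fun y => fderiv ℝ f y e) := by
  have h : ContDiff ℝ 1 (fderiv ℝ f) := hf.fderiv_right (by norm_num)
  exact (h.differentiable (by norm_num)).clm_apply (differentiable_const e)

variable [FiniteDimensional ℝ E]

theorem laplacian_eq_sum_fderiv {f : E → ℝ} (hf : ContDiff ℝ 2 f) (x : E) :
    (Δ f) x = ∑ i, fderiv ℝ (fun y => fderiv ℝ f y (stdOrthonormalBasis ℝ E i)) x
      (stdOrthonormalBasis ℝ E i) := by
  have h : ContDiff ℝ 1 (fderiv ℝ f) := hf.fderiv_right (by norm_num)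
  have hd : DifferentiableAt ℝ (fderiv ℝ f) x := (h.differentiable (by norm_num)).differentiableAt
  rw [laplacian_eq_iteratedFDeriv_stdOrthonormalBasis]
  refine Finset.sum_congr rfl fun i _ => ?_
  rw [iteratedFDeriv_two_apply]
  rw [fderiv_clm_apply hd (differentiableAt_const _)]
  simp

theorem ContDiff.continuous_laplacian {f : E → ℝ} (hf : ContDiff ℝ 2 f) : Continuous (Δ f) := by
  have h : ContDiff ℝ 1 (fderiv ℝ f) := hf.fderiv_right (by norm_num)
  have h2 : Δ f = fun x => ∑ i, fderiv ℝ (fun y => fderiv ℝ f y (stdOrthonormalBasis ℝ E i)) x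
      (stdOrthonormalBasis ℝ E i) := funext (laplacian_eq_sum_fderiv hf)
  rw [h2]
  refine continuous_finsetSum _ fun i _ => ?_
  have h3 : ContDiff ℝ 1 (fun y => fderiv ℝ f y (stdOrthonormalBasis ℝ E i)) :=
    h.clm_apply contDiff_const
  exact (h3.continuous_fderiv (by norm_num)).clm_apply continuous_const

theorem fderiv_apply_gradient_eq_sum (f g : E → ℝ) (x : E) :
    fderiv ℝ f x (∇ g x) = ∑ i, fderiv ℝ f x (stdOrthonormalBasis ℝ E i) *
      fderiv ℝ g x (stdOrthonormalBasis ℝ E i) := by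
  conv_lhs => rw [← (stdOrthonormalBasis ℝ E).sum_repr' (∇ g x)]
  rw [map_sum]
  refine Finset.sum_congr rfl fun i _ => ?_
  rw [map_smul, smul_eq_mul, mul_comm, real_inner_comm]
  congr 1
  rw [gradient, InnerProductSpace.toDual_symm_apply]

theorem sum_fderiv_sq_eq (f : E → ℝ) (x : E) :
    ∑ i, fderiv ℝ f x (stdOrthonormalBasis ℝ E i) ^ 2 = ‖∇ f x‖ ^ 2 := by
  rw [← (stdOrthonormalBasis ℝ E).sum_sq_norm_inner_right (∇ f x)]
  refine Finset.sum_congr rfl fun i _ => ?_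
  rw [Real.norm_eq_abs, sq_abs, real_inner_comm, gradient, InnerProductSpace.toDual_symm_apply]

theorem ContDiff.continuous_gradient {f : E → ℝ} (hf : ContDiff ℝ 1 f) : Continuous (∇ f) :=
  (InnerProductSpace.toDual ℝ E).symm.continuous.comp (hf.continuous_fderiv (by norm_num))

theorem laplacian_comp {w : E → ℝ} {J J' J'' : ℝ → ℝ} (hw : ContDiff ℝ 2 w)
    (hJw : ContDiff ℝ 2 (fun x => J (w x)))
    (h1 : ∀ x, HasDerivAt J (J' (w x)) (w x)) (h2 : ∀ x, HasDerivAt J' (J'' (w x)) (w x)) (x : E) :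
    (Δ (fun x => J (w x))) x = J'' (w x) * ‖∇ w x‖ ^ 2 + J' (w x) * (Δ w) x := by
  have hwd : Differentiable ℝ w := hw.differentiable (by norm_num)
  have e1 : ∀ y, fderiv ℝ (fun x => J (w x)) y = J' (w y) • fderiv ℝ w y := fun y =>
    ((h1 y).comp_hasFDerivAt y (hwd y).hasFDerivAt).fderiv
  rw [laplacian_eq_sum_fderiv hJw, laplacian_eq_sum_fderiv hw, ← sum_fderiv_sq_eq,
    Finset.mul_sum, Finset.mul_sum, ← Finset.sum_add_distrib]
  refine Finset.sum_congr rfl fun i _ => ?_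
  set e := stdOrthonormalBasis ℝ E i
  have h3 : HasFDerivAt (fun y => J' (w y) * fderiv ℝ w y e)
      (J' (w x) • fderiv ℝ (fun y => fderiv ℝ w y e) x +
        fderiv ℝ w x e • (J'' (w x) • fderiv ℝ w x)) x :=
    ((h2 x).comp_hasFDerivAt x (hwd x).hasFDerivAt).mul
      (hw.differentiable_fderiv_apply e x).hasFDerivAt
  simp only [e1, smul_apply, smul_eq_mul]
  rw [h3.fderiv]
  simp only [add_apply, smul_apply, smul_eq_mul]
  ring

theorem gradient_norm_sq (x : E) : ∇ (fun y : E => ‖y‖ ^ 2) x = (2 : ℝ) • x := by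
  have h : HasFDerivAt (fun y : E => ‖y‖ ^ 2) (2 • (innerSL ℝ x)) x :=
    (hasStrictFDerivAt_norm_sq x).hasFDerivAt
  refine ext_inner_right ℝ fun y => ?_
  rw [gradient, InnerProductSpace.toDual_symm_apply, h.fderiv]
  simp [inner_smul_left]

theorem laplacian_norm_sq (x : E) :
    (Δ (fun y : E => ‖y‖ ^ 2)) x = (2 * Module.finrank ℝ E : ℝ) := by
  rw [laplacian_eq_sum_fderiv (contDiff_norm_sq ℝ)]
  have h : ∀ y : E, fderiv ℝ (fun y : E => ‖y‖ ^ 2) y = 2 • (innerSL ℝ y) := fun y =>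
    (hasStrictFDerivAt_norm_sq y).hasFDerivAt.fderiv
  simp only [h]
  have h2 : ∀ i, fderiv ℝ (fun y : E => (2 • (innerSL ℝ y)) (stdOrthonormalBasis ℝ E i)) x
      (stdOrthonormalBasis ℝ E i) = 2 := by
    intro i
    have e : (fun y : E => (2 • (innerSL ℝ y)) (stdOrthonormalBasis ℝ E i)) =
        fun y => (2 • innerSL ℝ (stdOrthonormalBasis ℝ E i)) y := by
      ext y; simp [real_inner_comm]
    rw [e, ContinuousLinearMap.fderiv]
    simp
  rw [Finset.sum_congr rfl fun i _ => h2 i]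
  simp [mul_comm]

/-- A negative second derivative along a line would make the point a local maximum on that line as
well. The function would then be locally constant there, with second derivative zero. -/
theorem laplacian_nonneg_of_isLocalMin {f : E → ℝ} (hf : ContDiff ℝ 2 f) {x : E}
    (hx : IsLocalMin f x) : 0 ≤ (Δ f) x := by
  rw [laplacian_eq_sum_fderiv hf]
  refine Finset.sum_nonneg fun i _ => ?_
  set e := stdOrthonormalBasis ℝ E i
  by_contra! hneg
  have hl : ∀ t : ℝ, HasDerivAt (fun t : ℝ => x + t • e) e t := fun t => by
    simpa using ((hasDerivAt_id t).smul_const e).const_add x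
  have hd : ∀ t, HasDerivAt (fun t : ℝ => f (x + t • e)) (fderiv ℝ f (x + t • e) e) t := fun t =>
    ((hf.differentiable (by norm_num)) _).hasFDerivAt.comp_hasDerivAt t (hl t)
  have hd2 : HasDerivAt (fun t : ℝ => fderiv ℝ f (x + t • e) e)
      (fderiv ℝ (fun y => fderiv ℝ f y e) x e) 0 := by
    have h := (hf.differentiable_fderiv_apply e (x + (0 : ℝ) • e)).hasFDerivAt.comp_hasDerivAt
      0 (hl 0)
    simpa [Function.comp_def] using! h
  have hderiv : deriv (fun t : ℝ => f (x + t • e)) = fun t => fderiv ℝ f (x + t • e) e :=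
    funext fun t => (hd t).deriv
  have hf0 : fderiv ℝ f x = 0 := hx.fderiv_eq_zero
  have hc : ContinuousAt (fun t : ℝ => x + t • e) 0 := (hl 0).continuousAt
  have hmin : IsLocalMin (fun t : ℝ => f (x + t • e)) 0 := by
    have hx' : IsLocalMin f (x + (0 : ℝ) • e) := by simpa using hx
    exact hc.eventually hx'
  have hmax : IsLocalMax (fun t : ℝ => f (x + t • e)) 0 := by
    refine isLocalMax_of_deriv_deriv_neg ?_ ?_ (hd 0).continuousAt
    · rw [hderiv, hd2.deriv]; exact hneg
    · rw [hderiv]; simp [hf0]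
  have hconst : (fun t : ℝ => f (x + t • e)) =ᶠ[nhds 0] fun _ => f x := by
    filter_upwards [hmin, hmax] with t h1 h2
    simp only [zero_smul, add_zero] at h1 h2
    exact le_antisymm h2 h1
  have h0 : deriv (fun t : ℝ => f (x + t • e)) =ᶠ[nhds 0] fun _ => 0 := by
    refine hconst.deriv.trans ?_
    simp
  have h1 := h0.deriv_eq
  rw [hderiv, hd2.deriv] at h1
  simp at h1
  exact absurd h1 hneg.ne

end Calculus

/-! ### Green's identities -/

section Green

variable {E : Type*} [NormedAddCommGroup E] [InnerProductSpace ℝ E] [FiniteDimensional ℝ E]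
  [MeasurableSpace E] [BorelSpace E] (μ : Measure E) [μ.IsAddHaarMeasure]

/-- Green's first identity, when one of the two functions has compact support. -/
theorem integral_fderiv_apply_gradient {f g : E → ℝ} (hf : ContDiff ℝ 2 f) (hg : ContDiff ℝ 1 g)
    (hc : HasCompactSupport f ∨ HasCompactSupport g) :
    ∫ x, fderiv ℝ f x (∇ g x) ∂μ = -∫ x, (Δ f) x * g x ∂μ := by
  have hf' : ContDiff ℝ 1 (fderiv ℝ f) := hf.fderiv_right (by norm_num)
  have hfe : ∀ e, ContDiff ℝ 1 (fun y => fderiv ℝ f y e) := fun e => hf'.clm_apply contDiff_const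
  have cfe : ∀ e, HasCompactSupport f → HasCompactSupport (fun y => fderiv ℝ f y e) :=
    fun e h => (h.fderiv (𝕜 := ℝ)).comp_left (g := fun L : E →L[ℝ] ℝ => L e) rfl
  have cge : ∀ e, HasCompactSupport g → HasCompactSupport (fun y => fderiv ℝ g y e) :=
    fun e h => (h.fderiv (𝕜 := ℝ)).comp_left (g := fun L : E →L[ℝ] ℝ => L e) rfl
  have cfee : ∀ e, HasCompactSupport f →
      HasCompactSupport (fun y => fderiv ℝ (fun y => fderiv ℝ f y e) y e) :=
    fun e h => ((cfe e h).fderiv (𝕜 := ℝ)).comp_left (g := fun L : E →L[ℝ] ℝ => L e) rfl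
  have gce : ∀ e, Continuous (fun y => fderiv ℝ g y e) := fun e =>
    (hg.continuous_fderiv (by norm_num)).clm_apply continuous_const
  have fcee : ∀ e, Continuous (fun y => fderiv ℝ (fun y => fderiv ℝ f y e) y e) := fun e =>
    ((hfe e).continuous_fderiv (by norm_num)).clm_apply continuous_const
  have i1 : ∀ e, Integrable (fun x => fderiv ℝ f x e * fderiv ℝ g x e) μ := fun e =>
    ((hfe e).continuous.mul (gce e)).integrable_of_hasCompactSupport
      (hc.elim (fun h => (cfe e h).mul_right) fun h => (cge e h).mul_left)
  have i2 : ∀ e, Integrable (fun x => fderiv ℝ (fun y => fderiv ℝ f y e) x e * g x) μ := fun e =>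
    ((fcee e).mul hg.continuous).integrable_of_hasCompactSupport
      (hc.elim (fun h => (cfee e h).mul_right) fun h => h.mul_left)
  have i3 : ∀ e, Integrable (fun x => fderiv ℝ f x e * g x) μ := fun e =>
    ((hfe e).continuous.mul hg.continuous).integrable_of_hasCompactSupport
      (hc.elim (fun h => (cfe e h).mul_right) fun h => h.mul_left)
  simp_rw [fderiv_apply_gradient_eq_sum, laplacian_eq_sum_fderiv hf, Finset.sum_mul]
  rw [integral_finsetSum _ fun i _ => i1 _, integral_finsetSum _ fun i _ => i2 _,
    ← Finset.sum_neg_distrib]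
  refine Finset.sum_congr rfl fun i _ => ?_
  exact integral_mul_fderiv_eq_neg_fderiv_mul_of_integrable (i2 _) (i1 _) (i3 _)
    (fun x _ => ((hfe _).differentiable (by norm_num)).differentiableAt)
    (fun x _ => (hg.differentiable (by norm_num)).differentiableAt)

/-- Green's second identity. -/
theorem integral_mul_laplacian_comm {f g : E → ℝ} (hf : ContDiff ℝ 2 f) (hg : ContDiff ℝ 2 g)
    (hc : HasCompactSupport f) :
    ∫ x, (Δ f) x * g x ∂μ = ∫ x, f x * (Δ g) x ∂μ := by
  have h1 := integral_fderiv_apply_gradient μ hf (hg.of_le (by norm_num)) (Or.inl hc)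
  have h2 := integral_fderiv_apply_gradient μ hg (hf.of_le (by norm_num)) (Or.inr hc)
  have h3 : ∀ x, fderiv ℝ f x (∇ g x) = fderiv ℝ g x (∇ f x) := fun x => by
    rw [fderiv_apply_gradient_eq_sum, fderiv_apply_gradient_eq_sum]
    exact Finset.sum_congr rfl fun i _ => mul_comm _ _
  simp_rw [h3] at h1
  rw [h1] at h2
  rw [neg_inj.1 h2]
  simp_rw [mul_comm]

end Green

/-! ### Weighted mean value inequality -/

section MeanValue

variable {E : Type*} [NormedAddCommGroup E]

/-- The weight `(1 - |y|²)₊` used for averages over balls. -/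
noncomputable def ballWeight (y : E) : ℝ := max (1 - ‖y‖ ^ 2) 0

/-- A primitive of the radial weight: `∇ ballPotential = -ballWeight • id`. -/
noncomputable def ballPotential (y : E) : ℝ := (max (1 - ‖y‖ ^ 2) 0) ^ 2 / 4

theorem continuous_ballWeight : Continuous (ballWeight : E → ℝ) := by
  unfold ballWeight; fun_prop

theorem continuous_ballPotential : Continuous (ballPotential : E → ℝ) := by
  unfold ballPotential; fun_prop

theorem ballWeight_nonneg (y : E) : 0 ≤ ballWeight y := le_max_right _ _

theorem ballWeight_le_one (y : E) : ballWeight y ≤ 1 :=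
  max_le (by nlinarith [sq_nonneg ‖y‖]) zero_le_one

theorem ballPotential_nonneg (y : E) : 0 ≤ ballPotential y := by
  unfold ballPotential; positivity

theorem ballWeight_eq_zero {y : E} (hy : 1 ≤ ‖y‖) : ballWeight y = 0 :=
  max_eq_right (by nlinarith)

theorem ballPotential_eq_zero {y : E} (hy : 1 ≤ ‖y‖) : ballPotential y = 0 := by
  have h : max (1 - ‖y‖ ^ 2) 0 = 0 := max_eq_right (by nlinarith)
  simp [ballPotential, h]

theorem hasDerivAt_max_zero_sq (t : ℝ) :
    HasDerivAt (fun t : ℝ => (max t 0) ^ 2) (2 * max t 0) t := by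
  rcases lt_trichotomy t 0 with h | h | h
  · have e : (fun t : ℝ => (max t 0) ^ 2) =ᶠ[nhds t] fun _ => 0 := by
      filter_upwards [eventually_lt_nhds h] with s hs
      simp [max_eq_right hs.le]
    rw [max_eq_right h.le, mul_zero]
    exact (hasDerivAt_const t (0 : ℝ)).congr_of_eventuallyEq e
  · subst h
    rw [max_self, mul_zero]
    rw [hasDerivAt_iff_isLittleO]
    have : (fun x : ℝ => x ^ 2) =o[nhds 0] fun x : ℝ => x := by
      simpa using Asymptotics.isLittleO_pow_pow (𝕜 := ℝ) (m := 1) (n := 2) (by norm_num)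
    refine (Asymptotics.IsBigO.of_bound 1 (Filter.Eventually.of_forall fun x => ?_)).trans_isLittleO
      (by simpa using this)
    have h1 : max x 0 ≤ |x| := max_le (le_abs_self x) (abs_nonneg x)
    have h2 : (0 : ℝ) ≤ max x 0 := le_max_right _ _
    have h3 : (max x 0) ^ 2 ≤ |x| ^ 2 := by gcongr
    simpa [abs_of_nonneg h2] using h3
  · have e : (fun t : ℝ => (max t 0) ^ 2) =ᶠ[nhds t] fun t => t ^ 2 := by
      filter_upwards [eventually_gt_nhds h] with s hs
      simp [max_eq_left hs.le]
    rw [max_eq_left h.le]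
    simpa using (hasDerivAt_pow 2 t).congr_of_eventuallyEq e

variable [InnerProductSpace ℝ E]

theorem hasFDerivAt_ballPotential (y : E) :
    HasFDerivAt ballPotential (-(ballWeight y) • innerSL ℝ y) y := by
  have h1 : HasFDerivAt (fun y : E => 1 - ‖y‖ ^ 2) (-(2 • innerSL ℝ y)) y :=
    (hasStrictFDerivAt_norm_sq y).hasFDerivAt.const_sub 1
  have h2 := ((hasDerivAt_max_zero_sq (1 - ‖y‖ ^ 2)).comp_hasFDerivAt y h1).const_mul (1 / 4)
  refine HasFDerivAt.congr_fderiv (h2.congr_of_eventuallyEq (Filter.Eventually.of_forall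
    fun z => ?_)) ?_
  · simp [ballPotential]; ring
  · ext z
    simp [ballWeight]; ring

theorem contDiff_ballPotential : ContDiff ℝ 1 (ballPotential : E → ℝ) := by
  have h : fderiv ℝ (ballPotential : E → ℝ) = fun y => -(ballWeight y) • innerSL ℝ y :=
    funext fun y => (hasFDerivAt_ballPotential y).fderiv
  rw [contDiff_one_iff_fderiv]
  refine ⟨fun y => (hasFDerivAt_ballPotential y).differentiableAt, ?_⟩
  rw [h]
  exact continuous_ballWeight.neg.smul (innerSL ℝ).continuous

variable [FiniteDimensional ℝ E]

theorem gradient_ballPotential (y : E) : ∇ ballPotential y = -(ballWeight y) • y := by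
  refine ext_inner_right ℝ fun z => ?_
  rw [gradient, InnerProductSpace.toDual_symm_apply, (hasFDerivAt_ballPotential y).fderiv]
  simp [inner_smul_left]

theorem hasCompactSupport_ballWeight : HasCompactSupport (ballWeight : E → ℝ) :=
  HasCompactSupport.intro (isCompact_closedBall (0 : E) 1) fun y hy =>
    ballWeight_eq_zero (by simpa using (not_le.1 (by simpa using hy)).le)

theorem hasCompactSupport_ballPotential : HasCompactSupport (ballPotential : E → ℝ) :=
  HasCompactSupport.intro (isCompact_closedBall (0 : E) 1) fun y hy =>
    ballPotential_eq_zero (by simpa using (not_le.1 (by simpa using hy)).le)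

theorem laplacian_comp_add_smul {f : E → ℝ} (hf : ContDiff ℝ 2 f) (x : E) (s : ℝ) (y : E) :
    (Δ (fun y => f (x + s • y))) y = s ^ 2 * (Δ f) (x + s • y) := by
  have hl : ∀ y : E, HasFDerivAt (fun y : E => x + s • y) (s • ContinuousLinearMap.id ℝ E) y :=
    fun y => ((hasFDerivAt_id y).const_smul s).const_add x
  have hc : ContDiff ℝ 2 (fun y : E => x + s • y) := by fun_prop
  have e : ∀ y, fderiv ℝ (fun y => f (x + s • y)) y = s • fderiv ℝ f (x + s • y) := fun y => by
    have h : HasFDerivAt (fun y => f (x + s • y)) _ y :=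
      ((hf.differentiable (by norm_num)) _).hasFDerivAt.comp y (hl y)
    rw [h.fderiv]
    ext z; simp
  have hfc : ContDiff ℝ 2 (fun y => f (x + s • y)) := hf.comp hc
  rw [laplacian_eq_sum_fderiv hfc, laplacian_eq_sum_fderiv hf, Finset.mul_sum]
  refine Finset.sum_congr rfl fun i _ => ?_
  set v := stdOrthonormalBasis ℝ E i
  have h2 := (((hf.differentiable_fderiv_apply v) (x + s • y)).hasFDerivAt.comp y
    (hl y)).const_mul s
  have e2 : (fun y => fderiv ℝ (fun y => f (x + s • y)) y v) =
      fun y => s * fderiv ℝ f (x + s • y) v := by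
    funext y; simp [e]
  have e3 : fderiv ℝ (fun y => s * fderiv ℝ f (x + s • y) v) y = _ := h2.fderiv
  show fderiv ℝ (fun y => fderiv ℝ (fun y => f (x + s • y)) y v) y v = _
  rw [e2, e3]
  simp
  ring

variable [MeasurableSpace E] [BorelSpace E] (μ : Measure E) [μ.IsAddHaarMeasure]

/-- The weighted average (up to normalization) of `f` over the ball of radius `s` about `x`. -/
noncomputable def ballAverage (f : E → ℝ) (x : E) (s : ℝ) : ℝ :=
  ∫ y, f (x + s • y) * ballWeight y ∂μ

theorem integrable_ballAverage {f : E → ℝ} (hf : Continuous f) (x : E) (s : ℝ) :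
    Integrable (fun y => f (x + s • y) * ballWeight y) μ := by
  refine Continuous.integrable_of_hasCompactSupport ?_ (hasCompactSupport_ballWeight.mul_left)
  exact (hf.comp (by fun_prop)).mul continuous_ballWeight

/-- Differentiation under the integral produces `∇f(x + s y) · y` times the weight. Since the weight
times `y` is minus the gradient of `ballPotential`, Green's identity moves the derivative onto `f`.
The sign of `Δ f` thus decides the monotonicity in the radius. -/
theorem hasDerivAt_ballAverage {f : E → ℝ} (hf : ContDiff ℝ 2 f) (x : E) (s : ℝ) (hs : s ≠ 0) :
    HasDerivAt (ballAverage μ f x) (s * ∫ y, (Δ f) (x + s • y) * ballPotential y ∂μ) s := by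
  have hfd := hf.continuous_fderiv (by norm_num)
  have hcont : Continuous (fun q : ℝ × E => fderiv ℝ f (x + q.1 • q.2) q.2 * ballWeight q.2) :=
    ((hfd.comp (by fun_prop)).clm_apply continuous_snd).mul
      (continuous_ballWeight.comp continuous_snd)
  obtain ⟨C, hC⟩ := ((isCompact_closedBall s 1).prod
    (isCompact_closedBall (0 : E) 1)).exists_bound_of_continuousOn hcont.continuousOn
  -- Evaluation at `y = 0` suffices: the bounded function vanishes there.
  have hC0 : 0 ≤ C := (norm_nonneg _).trans (hC (s, 0) (by simp))
  have key := hasDerivAt_integral_of_dominated_loc_of_deriv_le (μ := μ) (𝕜 := ℝ)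
    (F := fun t y => f (x + t • y) * ballWeight y)
    (F' := fun t y => fderiv ℝ f (x + t • y) y * ballWeight y) (x₀ := s)
    (s := Metric.ball s 1) (bound := (Metric.closedBall (0 : E) 1).indicator fun _ => C)
    (Metric.ball_mem_nhds s one_pos)
    (Filter.Eventually.of_forall fun t =>
      (integrable_ballAverage μ hf.continuous x t).aestronglyMeasurable)
    (integrable_ballAverage μ hf.continuous x s)
    (hcont.comp (by fun_prop : Continuous fun y : E => (s, y))).aestronglyMeasurable
    (Filter.Eventually.of_forall fun y t ht => by
      by_cases hy : y ∈ Metric.closedBall (0 : E) 1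
      · rw [Set.indicator_of_mem hy]
        exact hC (t, y) ⟨Metric.ball_subset_closedBall ht, hy⟩
      · rw [Set.indicator_of_notMem hy,
          ballWeight_eq_zero (by simpa using (not_le.1 (by simpa using hy)).le)]
        simp)
    ((integrable_indicator_iff measurableSet_closedBall).2
      (integrableOn_const (isCompact_closedBall (0 : E) 1).measure_lt_top.ne))
    (Filter.Eventually.of_forall fun y t _ => by
      have hl : HasDerivAt (fun t : ℝ => x + t • y) y t := by
        simpa using ((hasDerivAt_id t).smul_const y).const_add x
      exact (((hf.differentiable (by norm_num)) _).hasFDerivAt.comp_hasDerivAt t hl).mul_const _)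
  have hval : ∫ y, fderiv ℝ f (x + s • y) y * ballWeight y ∂μ =
      s * ∫ y, (Δ f) (x + s • y) * ballPotential y ∂μ := by
    have hc : ContDiff ℝ 2 (fun y : E => x + s • y) := by fun_prop
    have g := integral_fderiv_apply_gradient μ (hf.comp hc)
      (contDiff_ballPotential (E := E)) (Or.inr hasCompactSupport_ballPotential)
    have e : ∀ y, fderiv ℝ (f ∘ fun y => x + s • y) y (∇ ballPotential y) =
        -s * (fderiv ℝ f (x + s • y) y * ballWeight y) := fun y => by
      have hl : HasFDerivAt (fun y : E => x + s • y) (s • ContinuousLinearMap.id ℝ E) y :=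
        ((hasFDerivAt_id y).const_smul s).const_add x
      rw [(((hf.differentiable (by norm_num)) _).hasFDerivAt.comp y hl).fderiv,
        gradient_ballPotential]
      simp only [ContinuousLinearMap.comp_apply, smul_apply, ContinuousLinearMap.id_apply,
        map_smul, smul_eq_mul]
      ring
    have e2 : ∀ y, (Δ (f ∘ fun y => x + s • y)) y * ballPotential y =
        s ^ 2 * ((Δ f) (x + s • y) * ballPotential y) := fun y => by
      rw [← mul_assoc, ← laplacian_comp_add_smul hf]
      rfl
    simp_rw [e, e2, integral_const_mul] at g
    have : s * (∫ y, fderiv ℝ f (x + s • y) y * ballWeight y ∂μ -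
      s * ∫ y, (Δ f) (x + s • y) * ballPotential y ∂μ) = 0 := by linarith
    linarith [(mul_eq_zero.1 this).resolve_left hs]
  rw [← hval]
  exact key.2

theorem continuous_ballAverage {f : E → ℝ} (hf : Continuous f) (x : E) :
    Continuous (ballAverage μ f x) := by
  rw [← continuousOn_univ]
  refine continuousOn_integral_of_compact_support (isCompact_closedBall (0 : E) 1)
    (Continuous.continuousOn ?_) fun t y _ hy => ?_
  · exact (hf.comp (by fun_prop : Continuous fun q : ℝ × E => x + q.1 • q.2)).mul
      (continuous_ballWeight.comp continuous_snd)
  · rw [ballWeight_eq_zero (by simpa using (not_le.1 (by simpa using hy)).le), mul_zero]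

/-- Mean value inequality for functions whose Laplacian is bounded below. -/
theorem mul_integral_ballWeight_le_ballAverage_add {f : E → ℝ} (hf : ContDiff ℝ 2 f) {x : E}
    {r L : ℝ} (hr : 0 ≤ r) (hL : ∀ z ∈ Metric.ball x r, -L ≤ (Δ f) z) :
    f x * ∫ y : E, ballWeight y ∂μ ≤
      ballAverage μ f x r + L * r ^ 2 / 2 * ∫ y : E, ballPotential y ∂μ := by
  set P := ∫ y : E, ballPotential y ∂μ
  have hd : ∀ s, 0 < s → HasDerivAt (fun s => ballAverage μ f x s + L * s ^ 2 / 2 * P)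
      (s * ∫ y, (Δ f) (x + s • y) * ballPotential y ∂μ + s * (L * P)) s := fun s hs => by
    refine (hasDerivAt_ballAverage μ hf x s hs.ne').add ?_
    have := (((hasDerivAt_pow 2 s).const_mul L).div_const 2).mul_const P
    refine this.congr_deriv ?_
    simp; ring
  have iP : Integrable (ballPotential : E → ℝ) μ :=
    continuous_ballPotential.integrable_of_hasCompactSupport hasCompactSupport_ballPotential
  -- The quadratic term compensates the lower bound `-L` on the Laplacian, so the derivative of the
  -- sum is nonnegative.
  have hmono : MonotoneOn (fun s => ballAverage μ f x s + L * s ^ 2 / 2 * P) (Set.Icc 0 r) := by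
    refine monotoneOn_of_deriv_nonneg (convex_Icc 0 r) ?_ ?_ ?_
    · exact ((continuous_ballAverage μ hf.continuous x).add (by fun_prop)).continuousOn
    · intro s hs
      rw [interior_Icc] at hs
      exact (hd s hs.1).differentiableAt.differentiableWithinAt
    · intro s hs
      rw [interior_Icc] at hs
      rw [(hd s hs.1).deriv, ← mul_add]
      refine mul_nonneg hs.1.le ?_
      have h1 : ∫ y : E, -L * ballPotential y ∂μ ≤
          ∫ y, (Δ f) (x + s • y) * ballPotential y ∂μ := by
        refine integral_mono (iP.const_mul _) ?_ fun y => ?_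
        · refine Continuous.integrable_of_hasCompactSupport ?_
            hasCompactSupport_ballPotential.mul_left
          exact (hf.continuous_laplacian.comp (by fun_prop)).mul continuous_ballPotential
        · rcases lt_or_ge ‖y‖ 1 with hy | hy
          · refine mul_le_mul_of_nonneg_right (hL _ ?_) (ballPotential_nonneg y)
            rw [Metric.mem_ball, dist_eq_norm, add_sub_cancel_left, norm_smul, Real.norm_eq_abs,
              abs_of_pos hs.1]
            nlinarith [hs.1, hs.2, norm_nonneg y]
          · simp [ballPotential_eq_zero hy]
      rw [integral_const_mul] at h1
      linarith
  have h := hmono ⟨le_refl 0, hr⟩ ⟨hr, le_refl r⟩ hr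
  have h0 : ballAverage μ f x 0 = f x * ∫ y : E, ballWeight y ∂μ := by
    simp [ballAverage, integral_const_mul]
  simp only [h0] at h
  linarith

end MeanValue

/-! ### Comparison of averages over different balls -/

section BallAverage

variable {E : Type*} [NormedAddCommGroup E] [InnerProductSpace ℝ E] [FiniteDimensional ℝ E]
  [MeasurableSpace E] [BorelSpace E] (μ : Measure E) [μ.IsAddHaarMeasure]

theorem integral_ballWeight_pos : 0 < ∫ y : E, ballWeight y ∂μ := by
  refine continuous_ballWeight.integral_pos_of_hasCompactSupport_nonneg_nonzero
    hasCompactSupport_ballWeight ballWeight_nonneg (x := 0) ?_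
  simp [ballWeight]

theorem integral_comp_add_smul (F : E → ℝ) (a : E) {r : ℝ} (hr : 0 < r) :
    ∫ y, F (a + r • y) ∂μ = (r ^ Module.finrank ℝ E)⁻¹ * ∫ y, F y ∂μ := by
  rw [Measure.integral_comp_smul_of_nonneg μ (fun y => F (a + y)) r (hR := hr.le),
    integral_add_left_eq_self (μ := μ) F a, smul_eq_mul]

theorem ballAverage_le_of_superharmonic {f : E → ℝ} (hf : ContDiff ℝ 2 f)
    (hΔ : ∀ x, (Δ f) x ≤ 0) (x : E) {r : ℝ} (hr : 0 ≤ r) :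
    ballAverage μ f x r ≤ f x * ∫ y : E, ballWeight y ∂μ := by
  have h := mul_integral_ballWeight_le_ballAverage_add μ (f := -f) (L := 0) hf.neg hr
    (x := x) fun z _ => by rw [laplacian_neg]; simpa using hΔ z
  have e : ballAverage μ (-f) x r = -ballAverage μ f x r := by
    simp [ballAverage, integral_neg]
  rw [e] at h
  simp at h
  linarith

/-- The ball of radius `r` about `x` lies in the ball of radius `2r` about `y`, where the weight of
the ball of radius `4r` is at least `3/4`. Rescaling from `r` to `4r` costs the factor `4 ^ d`. -/
theorem ballAverage_le_ballAverage_of_dist_le {f : E → ℝ} (hf : Continuous f) (h0 : ∀ x, 0 ≤ f x)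
    {x y : E} {r : ℝ} (hr : 0 < r) (hxy : ‖x - y‖ ≤ r) :
    ballAverage μ f x r ≤ 2 * 4 ^ Module.finrank ℝ E * ballAverage μ f y (4 * r) := by
  -- The position of `x` in the coordinates `w ↦ y + 4 r w`.
  set a : E := (4 * r)⁻¹ • (x - y)
  set F : E → ℝ := fun w => f (y + (4 * r) • w) * ballWeight w
  have hF : Integrable F μ := integrable_ballAverage μ hf y (4 * r)
  have hFa : ∀ z, F (a + (4 : ℝ)⁻¹ • z) = f (x + r • z) * ballWeight (a + (4 : ℝ)⁻¹ • z) := by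
    intro z
    have : y + (4 * r) • (a + (4 : ℝ)⁻¹ • z) = x + r • z := by
      rw [smul_add, smul_smul, smul_smul, mul_inv_cancel₀ (by positivity), one_smul,
        show 4 * r * 4⁻¹ = r by ring]
      abel
    simp only [F, this]
  have ha : ‖a‖ ≤ 1 / 4 := by
    rw [norm_smul, Real.norm_eq_abs, abs_of_pos (by positivity), inv_mul_le_iff₀ (by positivity)]
    linarith
  have hK : ∀ z : E, ballWeight z ≤ 2 * ballWeight (a + (4 : ℝ)⁻¹ • z) := by
    intro z
    rcases lt_or_ge ‖z‖ 1 with hz | hz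
    · have h1 : ‖a + (4 : ℝ)⁻¹ • z‖ ≤ 1 / 2 := by
        refine (norm_add_le _ _).trans ?_
        have h3 : ‖(4 : ℝ)⁻¹ • z‖ = 4⁻¹ * ‖z‖ := by
          rw [norm_smul, Real.norm_eq_abs, abs_of_pos (by positivity)]
        linarith
      have h2 : 1 - ‖a + (4 : ℝ)⁻¹ • z‖ ^ 2 ≤ ballWeight (a + (4 : ℝ)⁻¹ • z) := le_max_left _ _
      nlinarith [ballWeight_le_one z, norm_nonneg (a + (4 : ℝ)⁻¹ • z)]
    · rw [ballWeight_eq_zero hz]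
      exact mul_nonneg zero_le_two (ballWeight_nonneg _)
  have hint : Integrable (fun z => F (a + (4 : ℝ)⁻¹ • z)) μ :=
    (hF.comp_add_left a).comp_smul (by norm_num)
  calc ballAverage μ f x r ≤ ∫ z, 2 * F (a + (4 : ℝ)⁻¹ • z) ∂μ := by
        refine integral_mono (integrable_ballAverage μ hf x r) (hint.const_mul 2) fun z => ?_
        simp only [hFa]
        nlinarith [mul_le_mul_of_nonneg_left (hK z) (h0 (x + r • z))]
    _ = _ := by
        rw [integral_const_mul, integral_comp_add_smul μ F a (by norm_num), ballAverage]
        simp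
        ring

theorem exists_lt_of_memLp {u : E → ℝ} {q : ENNReal} [Nontrivial E] (hq : q ≠ 0) (hq' : q ≠ ⊤)
    (hu : MemLp u q μ) {ε : ℝ} (hε : 0 < ε) : ∃ x, u x < ε := by
  by_contra! h
  have h1 : MemLp (fun _ : E => ε) q μ :=
    hu.mono aestronglyMeasurable_const (Filter.Eventually.of_forall fun x => by
      rw [Real.norm_eq_abs, Real.norm_eq_abs, abs_of_pos hε]
      exact (h x).trans (le_abs_self _))
  rw [memLp_const_iff hq hq'] at h1
  rcases h1 with h1 | h1
  · exact hε.ne' h1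
  · rw [measure_univ_of_isAddLeftInvariant] at h1
    exact lt_irrefl _ h1

end BallAverage

/-! ### Liouville argument and uniqueness -/

section Liouville

variable {E : Type*} [NormedAddCommGroup E] [InnerProductSpace ℝ E] [FiniteDimensional ℝ E]

/-- A subharmonic function dominated by a sum of two nonnegative superharmonic functions with
infimum zero is nonpositive. -/
theorem nonpos_of_subharmonic_of_le_add {J u v : E → ℝ} (hJ : ContDiff ℝ 2 J)
    (hu : ContDiff ℝ 2 u) (hv : ContDiff ℝ 2 v) (hΔJ : ∀ x, 0 ≤ (Δ J) x)
    (hΔu : ∀ x, (Δ u) x ≤ 0) (hΔv : ∀ x, (Δ v) x ≤ 0) (hu0 : ∀ x, 0 ≤ u x) (hv0 : ∀ x, 0 ≤ v x)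
    (hui : ∀ ε : ℝ, 0 < ε → ∃ x, u x < ε) (hvi : ∀ ε : ℝ, 0 < ε → ∃ x, v x < ε)
    (hle : ∀ x, J x ≤ u x + v x) (x : E) : J x ≤ 0 := by
  let _ : MeasurableSpace E := borel E
  have _ : BorelSpace E := ⟨rfl⟩
  let μ : Measure E := volume
  set I := ∫ y : E, ballWeight y ∂μ
  have hI : 0 < I := integral_ballWeight_pos μ
  set C : ℝ := 2 * 4 ^ Module.finrank ℝ E
  have hC : 0 < C := by positivity
  refine le_of_forall_pos_le_add fun ε hε => ?_
  -- The tolerance absorbs the constant `C` of the ball comparison, so `u` and `v` contribute `ε /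
  -- 2` each.
  obtain ⟨y, hy⟩ := hui (ε / (2 * C)) (by positivity)
  obtain ⟨z, hz⟩ := hvi (ε / (2 * C)) (by positivity)
  set r := 1 + ‖x - y‖ + ‖x - z‖
  have hr : 0 < r := by positivity
  have h1 := mul_integral_ballWeight_le_ballAverage_add μ (L := 0) (x := x) hJ hr.le
    fun z _ => by simpa using hΔJ z
  have h2 : ballAverage μ J x r ≤ ballAverage μ u x r + ballAverage μ v x r := by
    unfold ballAverage
    rw [← integral_add (integrable_ballAverage μ hu.continuous x r)
      (integrable_ballAverage μ hv.continuous x r)]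
    refine integral_mono (integrable_ballAverage μ hJ.continuous x r)
      ((integrable_ballAverage μ hu.continuous x r).add
        (integrable_ballAverage μ hv.continuous x r)) fun w => ?_
    simp only
    rw [← add_mul]
    exact mul_le_mul_of_nonneg_right (hle _) (ballWeight_nonneg _)
  have h3 := ballAverage_le_ballAverage_of_dist_le μ hu.continuous hu0 (x := x) (y := y) hr
    (by simp only [r]; linarith [norm_nonneg (x - z)])
  have h4 := ballAverage_le_ballAverage_of_dist_le μ hv.continuous hv0 (x := x) (y := z) hr
    (by simp only [r]; linarith [norm_nonneg (x - y)])
  have h5 := ballAverage_le_of_superharmonic μ hu hΔu y (r := 4 * r) (by positivity)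
  have h6 := ballAverage_le_of_superharmonic μ hv hΔv z (r := 4 * r) (by positivity)
  have h7 : C * ballAverage μ u y (4 * r) ≤ C * (ε / (2 * C) * I) := by
    refine mul_le_mul_of_nonneg_left (h5.trans ?_) hC.le
    exact mul_le_mul_of_nonneg_right hy.le hI.le
  have h8 : C * ballAverage μ v z (4 * r) ≤ C * (ε / (2 * C) * I) := by
    refine mul_le_mul_of_nonneg_left (h6.trans ?_) hC.le
    exact mul_le_mul_of_nonneg_right hz.le hI.le
  have h9 : C * (ε / (2 * C) * I) = ε / 2 * I := by field_simp
  have h10 : J x * I ≤ ε * I := by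
    rw [h9] at h7 h8
    simp only [zero_mul, zero_div, add_zero] at h1
    change ballAverage μ u x r ≤ C * _ at h3
    change ballAverage μ v x r ≤ C * _ at h4
    linarith
  rw [zero_add]
  exact le_of_mul_le_mul_right h10 hI

/-- `√(1 + t²) - 1` serves as a smooth convex substitute for `|t|`, to which the chain rule for the
Laplacian applies. -/
theorem hasDerivAt_sqrt_one_add_sq (t : ℝ) :
    HasDerivAt (fun t : ℝ => √(1 + t ^ 2) - 1) (t / √(1 + t ^ 2)) t := by
  have h : HasDerivAt (fun t : ℝ => 1 + t ^ 2) (2 * t) t := by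
    simpa using (hasDerivAt_pow 2 t).const_add 1
  refine ((h.sqrt (by positivity)).sub_const 1).congr_deriv ?_
  field_simp

theorem hasDerivAt_div_sqrt_one_add_sq (t : ℝ) :
    HasDerivAt (fun t : ℝ => t / √(1 + t ^ 2)) (1 / √(1 + t ^ 2) ^ 3) t := by
  have h : HasDerivAt (fun t : ℝ => 1 + t ^ 2) (2 * t) t := by
    simpa using (hasDerivAt_pow 2 t).const_add 1
  have hs : √(1 + t ^ 2) ≠ 0 := (Real.sqrt_pos.2 (by positivity)).ne'
  have hsq : √(1 + t ^ 2) ^ 2 = 1 + t ^ 2 := Real.sq_sqrt (by positivity)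
  refine ((hasDerivAt_id t).div (h.sqrt (by positivity)) hs).congr_deriv ?_
  field_simp
  simp only [id]
  linear_combination hsq

/-- Two positive superharmonic functions with infimum zero coincide if their difference `w`
satisfies `Δ w = c w` with `c ≥ 0`. -/
theorem eq_of_laplacian_sub_eq_mul {u v c : E → ℝ} (hu : ContDiff ℝ 2 u) (hv : ContDiff ℝ 2 v)
    (hΔu : ∀ x, (Δ u) x ≤ 0) (hΔv : ∀ x, (Δ v) x ≤ 0) (hu0 : ∀ x, 0 ≤ u x) (hv0 : ∀ x, 0 ≤ v x)
    (hui : ∀ ε : ℝ, 0 < ε → ∃ x, u x < ε) (hvi : ∀ ε : ℝ, 0 < ε → ∃ x, v x < ε)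
    (hc : ∀ x, 0 ≤ c x) (hw : ∀ x, (Δ v) x - (Δ u) x = c x * (v x - u x)) : u = v := by
  have hwd : ContDiff ℝ 2 (v - u) := hv.sub hu
  have hJ : ContDiff ℝ 2 (fun x => √(1 + (v - u) x ^ 2) - 1) :=
    ((contDiff_const.add (hwd.pow 2)).sqrt fun x => by positivity).sub contDiff_const
  -- Convexity handles the gradient term. In the other term `J'(w)` has the sign of `w`, hence
  -- `J'(w) c w ≥ 0`.
  have hΔJ : ∀ x, 0 ≤ (Δ (fun x => √(1 + (v - u) x ^ 2) - 1)) x := fun x => by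
    rw [laplacian_comp (J := fun t => √(1 + t ^ 2) - 1) (J' := fun t => t / √(1 + t ^ 2))
      (J'' := fun t => 1 / √(1 + t ^ 2) ^ 3) hwd hJ
      (fun x => hasDerivAt_sqrt_one_add_sq _) (fun x => hasDerivAt_div_sqrt_one_add_sq _),
      hv.contDiffAt.laplacian_sub hu.contDiffAt, hw]
    have : (v - u) x / √(1 + (v - u) x ^ 2) * (c x * (v x - u x)) =
        c x * (v - u) x ^ 2 / √(1 + (v - u) x ^ 2) := by
      simp only [Pi.sub_apply]; ring
    rw [this]
    have := hc x
    positivity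
  funext x
  have h := nonpos_of_subharmonic_of_le_add hJ hu hv hΔJ hΔu hΔv hu0 hv0
    hui hvi (fun x => ?_) x
  · have h1 : √(1 + (v - u) x ^ 2) ≤ 1 := by linarith
    rw [Real.sqrt_le_one] at h1
    have h2 : (v - u) x = 0 := by nlinarith [sq_nonneg ((v - u) x)]
    simp only [Pi.sub_apply] at h2
    linarith
  · have h1 := hu0 x
    have h2 := hv0 x
    rw [sub_le_iff_le_add, Real.sqrt_le_left (by positivity)]
    simp only [Pi.sub_apply]
    nlinarith [mul_nonneg h1 h2]

end Liouville

/-! ### ε-regularity by point picking -/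

section Regularity

variable {E : Type*} [NormedAddCommGroup E] [InnerProductSpace ℝ E] [FiniteDimensional ℝ E]
  [MeasurableSpace E] [BorelSpace E] (μ : Measure E) [μ.IsAddHaarMeasure]

/-- The integral of `u ^ q` over a ball controls `M` from below, when `u` has value `M` at the
centre, is at most `K * M` in the ball, and satisfies a mean value inequality there. -/
theorem le_setIntegral_rpow_of_ballAverage {u : E → ℝ} (hu : Continuous u) (hpos : ∀ x, 0 < u x)
    {q K M r : ℝ} (hq : 0 < q) (hK : 0 < K) (hM : 0 < M) (hr : 0 < r) {x : E}
    (hint : Integrable (fun x => u x ^ q) μ) (hle : ∀ y ∈ Metric.ball x r, u y ≤ K * M)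
    (hmean : M * (∫ y : E, ballWeight y ∂μ) / 2 ≤ ballAverage μ u x r) :
    (∫ y : E, ballWeight y ∂μ) / 4 ≤
      K * 4 ^ q * (r ^ Module.finrank ℝ E * M ^ q)⁻¹ *
        ∫ y in Metric.ball x r, u y ^ q ∂μ := by
  set I := ∫ y : E, ballWeight y ∂μ
  set F : E → ℝ := (Metric.ball x r).indicator fun y => u y ^ q
  have hFi : Integrable F μ := hint.indicator measurableSet_ball
  have hFr : Integrable (fun y => F (x + r • y)) μ := (hFi.comp_add_left x).comp_smul hr.ne'
  have hKi : Integrable (ballWeight : E → ℝ) μ :=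
    continuous_ballWeight.integrable_of_hasCompactSupport hasCompactSupport_ballWeight
  have h0 : ∀ y, 0 ≤ F y := fun y => Set.indicator_nonneg (fun z _ => (Real.rpow_pos_of_pos
    (hpos z) q).le) y
  -- Split at the level `M / 4`. Above it `(4 u / M) ^ q ≥ 1`, so the bound `K * M` may be
  -- multiplied by this factor. After integration the part below the level takes up half of `M I /
  -- 2`, leaving `M I / 4`.
  have hpt : ∀ y : E, u (x + r • y) * ballWeight y ≤
      M / 4 * ballWeight y + K * M * (4 / M) ^ q * F (x + r • y) := by
    intro y
    have hC : 0 ≤ K * M * (4 / M) ^ q := by positivity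
    rcases lt_or_ge ‖y‖ 1 with hy | hy
    · have hmem : x + r • y ∈ Metric.ball x r := by
        rw [Metric.mem_ball, dist_eq_norm, add_sub_cancel_left, norm_smul, Real.norm_eq_abs,
          abs_of_pos hr]
        nlinarith
      have hFy : F (x + r • y) = u (x + r • y) ^ q := Set.indicator_of_mem hmem _
      rw [hFy]
      have hw0 := ballWeight_nonneg y
      have hw1 := ballWeight_le_one y
      have hu0 := hpos (x + r • y)
      rcases le_or_gt (u (x + r • y)) (M / 4) with h | h
      · have : 0 ≤ u (x + r • y) ^ q := by positivity
        nlinarith [mul_le_mul_of_nonneg_right h hw0, mul_nonneg hC this]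
      · have h1 : 1 ≤ (4 / M) ^ q * u (x + r • y) ^ q := by
          rw [← Real.mul_rpow (by positivity) hu0.le]
          refine Real.one_le_rpow ?_ hq.le
          rw [div_mul_eq_mul_div, le_div_iff₀ hM]
          linarith
        have h2 := hle _ hmem
        have h3 : u (x + r • y) * ballWeight y ≤ K * M := by nlinarith
        have h4 : K * M * 1 ≤ K * M * ((4 / M) ^ q * u (x + r • y) ^ q) :=
          mul_le_mul_of_nonneg_left h1 (by positivity)
        have h5 : 0 ≤ M / 4 * ballWeight y := by positivity
        linarith
    · rw [ballWeight_eq_zero hy]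
      have := mul_nonneg hC (h0 (x + r • y))
      linarith
  have hI : ballAverage μ u x r ≤ M / 4 * I + K * M * (4 / M) ^ q *
      ((r ^ Module.finrank ℝ E)⁻¹ * ∫ y in Metric.ball x r, u y ^ q ∂μ) := by
    rw [← integral_indicator measurableSet_ball, ← integral_comp_add_smul μ F x hr,
      ← integral_const_mul, ← integral_const_mul,
      ← integral_add (hKi.const_mul _) (hFr.const_mul _)]
    exact integral_mono (integrable_ballAverage μ hu x r)
      ((hKi.const_mul _).add (hFr.const_mul _)) hpt
  set S := ∫ y in Metric.ball x r, u y ^ q ∂μ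
  have h1 : M * (I / 4) ≤ M * (K * 4 ^ q * (r ^ Module.finrank ℝ E * M ^ q)⁻¹ * S) := by
    have e : K * M * (4 / M) ^ q * ((r ^ Module.finrank ℝ E)⁻¹ * S) =
        M * (K * 4 ^ q * (r ^ Module.finrank ℝ E * M ^ q)⁻¹ * S) := by
      rw [Real.div_rpow (by norm_num) hM.le, mul_inv]
      ring
    rw [← e]
    linarith
  exact le_of_mul_le_mul_left h1 hM

/-- Scale invariant `ε`-regularity for `-Δ u = A u ^ p`. -/
theorem exists_pos_forall_rpow_mul_le {A p δ : ℝ} (hA : 0 ≤ A) (hp : 1 < p) (hδ : 0 < δ)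
    (hd : 0 < Module.finrank ℝ E) :
    ∃ ε : ℝ, 0 < ε ∧ ∀ u : E → ℝ, ContDiff ℝ 2 u → (∀ x, 0 < u x) →
      (∀ x, -(Δ u) x = A * u x ^ p) →
      Integrable (fun x => u x ^ (Module.finrank ℝ E * (p - 1) / 2)) μ →
      ∀ x R, 0 < R → ∫ y in Metric.ball x R, u y ^ (Module.finrank ℝ E * (p - 1) / 2) ∂μ < ε →
        u x ^ ((p - 1) / 2) * R ≤ δ := by
  set d := Module.finrank ℝ E
  -- Under the scaling of the equation, `u ^ α` is an inverse length.
  set α := (p - 1) / 2 with hα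
  have hα0 : 0 < α := by simp only [α]; linarith
  set q : ℝ := d * (p - 1) / 2 with hq
  have hd' : (0 : ℝ) < d := by exact_mod_cast hd
  have hq0 : 0 < q := by have : 0 < p - 1 := by linarith
                         positivity
  have hqα : q = α * d := by simp only [q, α]; ring
  set I := ∫ y : E, ballWeight y ∂μ
  have hI : 0 < I := integral_ballWeight_pos μ
  set P := ∫ y : E, ballPotential y ∂μ
  have hP : 0 ≤ P := integral_nonneg fun y => ballPotential_nonneg y
  set K : ℝ := 2 ^ α⁻¹
  have hK : 0 < K := by positivity
  have hKα : K ^ α = 2 := Real.rpow_inv_rpow (by norm_num) hα0.ne'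
  set T := A * K ^ p * δ ^ 2 * P
  have hT : 0 ≤ T := by positivity
  -- The bound `1 / 2` keeps the small ball inside the region of doubling; the other bound makes the
  -- Laplacian term in the mean value inequality at most half of the main term.
  set c := min (1 / 2) (I / (T + 1))
  have hc0 : 0 < c := lt_min (by norm_num) (by positivity)
  have hc1 : c ≤ 1 / 2 := min_le_left _ _
  have hcT : T * c ^ 2 ≤ I := by
    have h1 : c ≤ I / (T + 1) := min_le_right _ _
    rw [le_div_iff₀ (by positivity)] at h1
    have h2 : c ^ 2 ≤ c := by nlinarith
    nlinarith [mul_le_mul_of_nonneg_left h2 hT]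
  refine ⟨I / 4 * (c * δ) ^ d / (K * 4 ^ q), by positivity, ?_⟩
  intro u hu hpos heq hint x R hR hsmall
  by_contra! hcon
  -- Point picking: at a maximum `z` of `u ^ α` times the distance to the sphere, `u ^ α` at most
  -- doubles on the ball about `z` of half that distance `2σ`. This is why `K ^ α = 2`.
  obtain ⟨z, hz, hmax⟩ := (isCompact_closedBall x R).exists_isMaxOn
    (Metric.nonempty_closedBall.2 hR.le) (f := fun y => u y ^ α * (R - ‖y - x‖))
    (Continuous.continuousOn
      ((hu.continuous.rpow_const fun y => Or.inl (hpos y).ne').mul (by fun_prop)))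
  set M := u z
  have hM : 0 < M := hpos z
  have hMα : 0 < M ^ α := by positivity
  set σ := (R - ‖z - x‖) / 2 with hσ
  have hg : δ < M ^ α * (2 * σ) := by
    have h1 : u x ^ α * (R - ‖x - x‖) ≤ M ^ α * (R - ‖z - x‖) :=
      hmax (Metric.mem_closedBall_self hR.le)
    rw [sub_self, norm_zero, sub_zero] at h1
    rw [hσ, mul_div_cancel₀ _ (by norm_num : (2 : ℝ) ≠ 0)]
    linarith
  have hσ0 : 0 < σ := by
    by_contra! h
    nlinarith
  -- The natural length scale at `z`; `r ≤ σ` follows from `δ < 2 σ M ^ α` and `c ≤ 1 / 2`.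
  set r := c * δ / M ^ α
  have hr : 0 < r := by positivity
  have hrσ : r ≤ σ := by
    rw [div_le_iff₀ hMα]
    nlinarith
  have hsub : Metric.ball z r ⊆ Metric.ball x R := by
    refine Metric.ball_subset_ball' ?_
    rw [dist_eq_norm]
    linarith
  have hle : ∀ y ∈ Metric.ball z r, u y ≤ K * M := by
    intro y hy
    have h1 : u y ^ α * (R - ‖y - x‖) ≤ M ^ α * (R - ‖z - x‖) :=
      hmax (Metric.ball_subset_closedBall (hsub hy))
    have h2 : σ ≤ R - ‖y - x‖ := by
      rw [Metric.mem_ball, dist_eq_norm] at hy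
      have h3 : ‖y - x‖ ≤ ‖y - z‖ + ‖z - x‖ := norm_sub_le_norm_sub_add_norm_sub y z x
      linarith
    have h4 : u y ^ α ≤ (K * M) ^ α := by
      rw [Real.mul_rpow hK.le hM.le, hKα]
      have h5 : u y ^ α * σ ≤ u y ^ α * (R - ‖y - x‖) :=
        mul_le_mul_of_nonneg_left h2 (by have := hpos y; positivity)
      refine le_of_mul_le_mul_right (a := σ) ?_ hσ0
      have h6 : R - ‖z - x‖ = 2 * σ := by rw [hσ]; ring
      rw [h6] at h1
      linarith
    exact (Real.rpow_le_rpow_iff (hpos y).le (by positivity) hα0).1 h4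
  have hmv := mul_integral_ballWeight_le_ballAverage_add μ hu (x := z) (r := r)
    (L := A * (K * M) ^ p) hr.le fun y hy => by
      rw [neg_le, heq]
      exact mul_le_mul_of_nonneg_left
        (Real.rpow_le_rpow (hpos y).le (hle y hy) (by linarith)) hA
  have hMp : M ^ p = M * (M ^ α) ^ 2 := by
    rw [← Real.rpow_natCast (M ^ α) 2, ← Real.rpow_mul hM.le]
    nth_rewrite 2 [← Real.rpow_one M]
    rw [← Real.rpow_add hM]
    congr 1
    simp only [α]; push_cast; ring
  have herr : A * (K * M) ^ p * r ^ 2 / 2 * P ≤ M * I / 2 := by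
    have e : A * (K * M) ^ p * r ^ 2 / 2 * P = M * (T * c ^ 2) / 2 := by
      rw [Real.mul_rpow hK.le hM.le, hMp]
      simp only [r, T]
      field_simp
    rw [e]
    have := mul_le_mul_of_nonneg_left hcT hM.le
    linarith
  have hfin := le_setIntegral_rpow_of_ballAverage μ hu.continuous hpos hq0 hK hM hr (x := z)
    hint hle (by change M * I ≤ _ + _ * P at hmv; linarith)
  -- Scale invariance: `M` drops out, so the lower bound on the integral depends only on the
  -- constants and contradicts the smallness.
  have hrd : r ^ d * M ^ q = (c * δ) ^ d := by
    rw [hqα, Real.rpow_mul hM.le, Real.rpow_natCast, ← mul_pow]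
    simp only [r]
    field_simp
  have hmono : ∫ y in Metric.ball z r, u y ^ q ∂μ ≤ ∫ y in Metric.ball x R, u y ^ q ∂μ :=
    setIntegral_mono_set hint.integrableOn
      (Filter.Eventually.of_forall fun y => (Real.rpow_pos_of_pos (hpos y) q).le)
      hsub.eventuallyLE
  change I / 4 ≤ K * 4 ^ q * (r ^ d * M ^ q)⁻¹ * _ at hfin
  rw [hrd] at hfin
  have h1 : K * 4 ^ q * ((c * δ) ^ d)⁻¹ * ∫ y in Metric.ball z r, u y ^ q ∂μ <
      K * 4 ^ q * ((c * δ) ^ d)⁻¹ * (I / 4 * (c * δ) ^ d / (K * 4 ^ q)) :=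
    mul_lt_mul_of_pos_left (hmono.trans_lt hsmall) (by positivity)
  have e : K * 4 ^ q * ((c * δ) ^ d)⁻¹ * (I / 4 * (c * δ) ^ d / (K * 4 ^ q)) = I / 4 := by
    field_simp
  linarith

end Regularity

/-! ### Comparison with powers of `1 + |x|²` -/

section Comparison

variable {E : Type*} [NormedAddCommGroup E] [InnerProductSpace ℝ E]

theorem contDiff_one_add_norm_sq_rpow (b : ℝ) {k : WithTop ℕ∞} :
    ContDiff ℝ k (fun x : E => (1 + ‖x‖ ^ 2) ^ (-b)) :=
  (contDiff_const.add (contDiff_norm_sq ℝ)).rpow_const_of_ne fun x => by positivity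

variable [FiniteDimensional ℝ E]

/-- With `s = 1 + |x|²`, the left side equals the right side minus `4 b (b + 1) s^(-b-1)`, which has
a favourable sign and is dropped. -/
theorem laplacian_one_add_norm_sq_rpow_mul_le {b : ℝ} (hb : 0 ≤ b) (x : E) :
    (Δ (fun x : E => ((1 + ‖x‖ ^ 2) ^ (-b) : ℝ))) x * (1 + ‖x‖ ^ 2) ≤
      -(b * (2 * Module.finrank ℝ E - 4 - 4 * b)) * (1 + ‖x‖ ^ 2) ^ (-b) := by
  have h1 : ∀ c : ℝ, ∀ x : E, HasDerivAt (fun t : ℝ => (1 + t) ^ c)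
      (c * (1 + ‖x‖ ^ 2) ^ (c - 1)) (‖x‖ ^ 2) := fun c x => by
    have h := ((hasDerivAt_id (‖x‖ ^ 2)).const_add 1).rpow_const (p := c)
      (Or.inl (by simp only [id]; positivity))
    simpa using h
  rw [laplacian_comp (w := fun x : E => ‖x‖ ^ 2) (J := fun t => (1 + t) ^ (-b))
    (J' := fun t => -b * (1 + t) ^ (-b - 1))
    (J'' := fun t => -b * ((-b - 1) * (1 + t) ^ (-b - 1 - 1)))
    (contDiff_norm_sq ℝ) (contDiff_one_add_norm_sq_rpow b) (h1 (-b))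
    (fun x => (h1 (-b - 1) x).const_mul _), laplacian_norm_sq, gradient_norm_sq, norm_smul,
    Real.norm_eq_abs, abs_two]
  set s := 1 + ‖x‖ ^ 2 with hs
  have hs0 : 0 < s := by positivity
  have e : ‖x‖ ^ 2 = s - 1 := by rw [hs]; ring
  rw [mul_pow, e, Real.rpow_sub_one hs0.ne', Real.rpow_sub_one hs0.ne']
  have h2 : 0 < s ^ (-b) := by positivity
  have h3 : 0 ≤ b * (b + 1) * (s ^ (-b) / s) := by positivity
  have e2 : (-b * ((-b - 1) * (s ^ (-b) / s / s)) * (2 ^ 2 * (s - 1)) +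
      -b * (s ^ (-b) / s) * (2 * Module.finrank ℝ E)) * s =
      -(b * (2 * Module.finrank ℝ E - 4 - 4 * b)) * s ^ (-b) -
        4 * (b * (b + 1) * (s ^ (-b) / s)) := by
    field_simp
    ring
  rw [e2]
  linarith

/-- If `κ ≤ b (2 d - 4 - 4 b)`, then `(1 + |x|²)^(-b)` is a supersolution of
`-Δ w = κ (1 + |x|²)⁻¹ w`. A positive solution of `-Δ u = V u` with `V` smaller than the potential
of two such supersolutions outside of a ball, and which is dominated by the more slowly decaying
one, is bounded by the other. -/
theorem exists_forall_le_one_add_norm_sq_rpow {u V : E → ℝ} (hu : ContDiff ℝ 2 u)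
    (hpos : ∀ x, 0 < u x) (heq : ∀ x, -(Δ u) x = V x * u x) {κ b b' R₀ : ℝ}
    (hb : 0 ≤ b) (hb' : 0 ≤ b') (hκ : κ ≤ b * (2 * Module.finrank ℝ E - 4 - 4 * b))
    (hκ' : κ ≤ b' * (2 * Module.finrank ℝ E - 4 - 4 * b'))
    (hV : ∀ x, R₀ ≤ ‖x‖ → V x * (1 + ‖x‖ ^ 2) < κ)
    (hdec : ∀ η : ℝ, 0 < η → ∃ R, ∀ x, R ≤ ‖x‖ → u x ≤ η * (1 + ‖x‖ ^ 2) ^ (-b')) :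
    ∃ C, 0 ≤ C ∧ ∀ x, u x ≤ C * (1 + ‖x‖ ^ 2) ^ (-b) := by
  have hpp : ∀ (c : ℝ) (x : E), 0 < (1 + ‖x‖ ^ 2) ^ (-c) := fun c x => by positivity
  obtain ⟨C, hC⟩ := (isCompact_closedBall (0 : E) R₀).exists_bound_of_continuousOn
    (f := fun x => u x / (1 + ‖x‖ ^ 2) ^ (-b)) (hu.continuous.div
      (contDiff_one_add_norm_sq_rpow b (k := 0)).continuous fun x => (hpp b x).ne').continuousOn
  have hC1 : ∀ x : E, ‖x‖ ≤ R₀ → u x ≤ |C| * (1 + ‖x‖ ^ 2) ^ (-b) := fun x hx => by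
    rw [← div_le_iff₀ (hpp b x)]
    exact (le_abs_self _).trans ((hC x (by simpa using hx)).trans (le_abs_self _))
  refine ⟨|C|, abs_nonneg C, ?_⟩
  -- The slowly decaying term dominates `u` near infinity for each `δ > 0`, which localizes the
  -- comparison to a ball; `δ → 0` at the end.
  have key : ∀ δ : ℝ, 0 < δ → ∀ x, u x ≤ |C| * (1 + ‖x‖ ^ 2) ^ (-b) + δ * (1 + ‖x‖ ^ 2) ^ (-b') := by
    intro δ hδ
    by_contra! hcon
    obtain ⟨x₁, hx₁⟩ := hcon
    set Φ : E → ℝ := fun x => |C| * (1 + ‖x‖ ^ 2) ^ (-b) + δ * (1 + ‖x‖ ^ 2) ^ (-b')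
    have d1 : ContDiff ℝ 2 (fun x : E => (1 + ‖x‖ ^ 2) ^ (-b)) := contDiff_one_add_norm_sq_rpow b
    have d2 : ContDiff ℝ 2 (fun x : E => (1 + ‖x‖ ^ 2) ^ (-b')) := contDiff_one_add_norm_sq_rpow b'
    have hΦ : ContDiff ℝ 2 Φ := (contDiff_const.mul d1).add (contDiff_const.mul d2)
    have hΦ0 : ∀ x, 0 < Φ x := fun x => by
      have := hpp b x; have := hpp b' x
      positivity
    have hΦΔ : ∀ x, (Δ Φ) x * (1 + ‖x‖ ^ 2) ≤ -κ * Φ x := fun x => by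
      have e : (Δ Φ) x = |C| * (Δ (fun x : E => ((1 + ‖x‖ ^ 2) ^ (-b) : ℝ))) x +
          δ * (Δ (fun x : E => ((1 + ‖x‖ ^ 2) ^ (-b') : ℝ))) x := by
        rw [← smul_eq_mul, ← smul_eq_mul, ← laplacian_smul _ d1.contDiffAt,
          ← laplacian_smul _ d2.contDiffAt]
        exact (d1.const_smul |C|).contDiffAt.laplacian_add (d2.const_smul δ).contDiffAt
      have h1 := (laplacian_one_add_norm_sq_rpow_mul_le hb x).trans
        (mul_le_mul_of_nonneg_right (neg_le_neg hκ) (hpp b x).le)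
      have h2 := (laplacian_one_add_norm_sq_rpow_mul_le hb' x).trans
        (mul_le_mul_of_nonneg_right (neg_le_neg hκ') (hpp b' x).le)
      rw [e]
      have h3 := mul_le_mul_of_nonneg_left h1 (abs_nonneg C)
      have h4 := mul_le_mul_of_nonneg_left h2 hδ.le
      simp only [Φ]
      linarith
    obtain ⟨R, hR⟩ := hdec δ hδ
    have hout : ∀ x : E, R ≤ ‖x‖ → u x ≤ Φ x := fun x hx => (hR x hx).trans
      (le_add_of_nonneg_left (mul_nonneg (abs_nonneg C) (hpp b x).le))
    have hx₁R : ‖x₁‖ < R := by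
      by_contra! h
      exact absurd (hout x₁ h) (not_le.2 hx₁)
    -- If `u ≤ Φ` fails, the largest ratio `k` exceeds `1` and is attained at a point with `‖x₀‖ ≥
    -- R₀`. There `k Φ - u` has a minimum with value zero, and its Laplacian would be negative
    -- because `V (1 + |x|²) < κ`.
    obtain ⟨x₀, hx₀, hmax⟩ := (isCompact_closedBall (0 : E) R).exists_isMaxOn
      ⟨x₁, by simpa using hx₁R.le⟩ (f := fun x => u x / Φ x)
      (hu.continuous.div hΦ.continuous fun x => (hΦ0 x).ne').continuousOn
    set k := u x₀ / Φ x₀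
    have hk : 1 < k := by
      have h1 : u x₁ / Φ x₁ ≤ k := hmax (by simpa using hx₁R.le)
      exact ((one_lt_div (hΦ0 x₁)).2 hx₁).trans_le h1
    have hglob : ∀ x, u x ≤ k * Φ x := fun x => by
      rcases le_or_gt ‖x‖ R with h | h
      · exact (div_le_iff₀ (hΦ0 x)).1 (hmax (by simpa using h))
      · have := hout x h.le
        nlinarith [hΦ0 x]
    have hux₀ : u x₀ = k * Φ x₀ := (div_mul_cancel₀ _ (hΦ0 x₀).ne').symm
    have hx₀R : R₀ ≤ ‖x₀‖ := by
      by_contra! h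
      have h1 := hC1 x₀ h.le
      have h2 : u x₀ ≤ Φ x₀ := h1.trans (le_add_of_nonneg_right (by have := hpp b' x₀; positivity))
      nlinarith [hΦ0 x₀]
    have hmin : IsLocalMin (k • Φ - u) x₀ := Filter.Eventually.of_forall fun x => by
      have := hglob x
      simp only [Pi.sub_apply, Pi.smul_apply, smul_eq_mul]
      linarith
    have hkΦ : ContDiff ℝ 2 (k • Φ) := hΦ.const_smul k
    have hlap := laplacian_nonneg_of_isLocalMin (f := k • Φ - u) (hkΦ.sub hu) hmin
    rw [hkΦ.contDiffAt.laplacian_sub hu.contDiffAt,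
      laplacian_smul k hΦ.contDiffAt, smul_eq_mul] at hlap
    have h1 := heq x₀
    have h2 := mul_le_mul_of_nonneg_left (hΦΔ x₀) (zero_le_one.trans hk.le)
    have h3 := mul_lt_mul_of_pos_right (hV x₀ hx₀R) (hpos x₀)
    have hs0 : 0 < 1 + ‖x₀‖ ^ 2 := by positivity
    have h4 := mul_nonneg hlap hs0.le
    have h5 : (Δ u) x₀ = -(V x₀ * u x₀) := by linarith
    have h6 : k * (-κ * Φ x₀) = -κ * u x₀ := by rw [hux₀]; ring
    rw [h5] at h4
    linarith
  intro x
  refine le_of_forall_pos_le_add fun ε hε => ?_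
  have h := key (ε / (1 + ‖x‖ ^ 2) ^ (-b')) (div_pos hε (hpp b' x)) x
  rwa [div_mul_cancel₀ _ (hpp b' x).ne'] at h

end Comparison

/-! ### Decay at infinity -/

section Decay

variable {E : Type*} [NormedAddCommGroup E] [InnerProductSpace ℝ E] [FiniteDimensional ℝ E]
  [MeasurableSpace E] [BorelSpace E] (μ : Measure E) [μ.IsAddHaarMeasure]

theorem exists_setIntegral_compl_ball_lt {E : Type*} [NormedAddCommGroup E] [MeasurableSpace E]
    [BorelSpace E] (μ : Measure E) {f : E → ℝ} (hf : Integrable f μ) {ε : ℝ} (hε : 0 < ε) :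
    ∃ N : ℕ, ∫ x in (Metric.ball (0 : E) N)ᶜ, f x ∂μ < ε := by
  have h := tendsto_setIntegral_of_antitone (μ := μ) (f := f)
    (s := fun N : ℕ => (Metric.ball (0 : E) N)ᶜ) (fun N => measurableSet_ball.compl)
    (fun a b hab => Set.compl_subset_compl.2 (Metric.ball_subset_ball (by exact_mod_cast hab)))
    ⟨0, hf.integrableOn⟩
  have h0 : ⋂ N : ℕ, (Metric.ball (0 : E) N)ᶜ = ∅ := by
    rw [← Set.compl_iUnion, Metric.iUnion_ball_nat, Set.compl_univ]
  rw [h0, setIntegral_empty] at h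
  exact (h.eventually_lt_const hε).exists

/-- Solutions of `-Δ u = A u ^ p` that are integrable to the scale invariant power are
`o(|x|^(-2 / (p - 1)))` at infinity. -/
theorem exists_forall_rpow_mul_norm_le {u : E → ℝ} {A p δ : ℝ} (hA : 0 ≤ A) (hp : 1 < p)
    (hδ : 0 < δ) (hd : 0 < Module.finrank ℝ E) (hu : ContDiff ℝ 2 u) (hpos : ∀ x, 0 < u x)
    (heq : ∀ x, -(Δ u) x = A * u x ^ p)
    (hint : Integrable (fun x => u x ^ (Module.finrank ℝ E * (p - 1) / 2)) μ) :
    ∃ R : ℝ, 1 ≤ R ∧ ∀ x, R ≤ ‖x‖ → u x ^ ((p - 1) / 2) * ‖x‖ ≤ δ := by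
  obtain ⟨ε, hε, h⟩ := exists_pos_forall_rpow_mul_le μ hA hp (half_pos hδ) hd
  obtain ⟨N, hN⟩ := exists_setIntegral_compl_ball_lt μ hint hε
  -- For `‖x‖ ≥ 2N` the ball of radius `‖x‖ / 2` about `x` avoids the ball of radius `N` about the
  -- origin.
  refine ⟨max 1 (2 * N), le_max_left _ _, fun x hx => ?_⟩
  have hx1 : 1 ≤ ‖x‖ := (le_max_left _ _).trans hx
  have hx2 : 2 * N ≤ ‖x‖ := (le_max_right _ _).trans hx
  have h1 := h u hu hpos heq hint x (‖x‖ / 2) (by linarith) (lt_of_le_of_lt ?_ hN)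
  · linarith
  · refine setIntegral_mono_set hint.integrableOn
      (Filter.Eventually.of_forall fun y => (Real.rpow_pos_of_pos (hpos y) _).le)
      (LE.le.eventuallyLE fun y hy => ?_)
    rw [Metric.mem_ball, dist_eq_norm] at hy
    rw [Set.mem_compl_iff, Metric.mem_ball, dist_zero_right, not_lt]
    have := norm_sub_norm_le x y
    rw [norm_sub_rev] at hy
    linarith

/-- Almost the decay of the fundamental solution. -/
theorem exists_forall_le_one_add_norm_sq_rpow_of_integrable {u : E → ℝ} {A p b : ℝ} (hA : 0 ≤ A)
    (hp : 1 < p) (hu : ContDiff ℝ 2 u) (hpos : ∀ x, 0 < u x) (heq : ∀ x, -(Δ u) x = A * u x ^ p)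
    (hint : Integrable (fun x => u x ^ (Module.finrank ℝ E * (p - 1) / 2)) μ)
    (hb : 0 < b) (hbd : 2 * b < Module.finrank ℝ E - 2) :
    ∃ C, 0 ≤ C ∧ ∀ x, u x ≤ C * (1 + ‖x‖ ^ 2) ^ (-b) := by
  set d := Module.finrank ℝ E
  have hd : 0 < d := by
    rw [Nat.pos_iff_ne_zero]; intro h; rw [h] at hbd; norm_num at hbd; linarith
  set α := (p - 1) / 2 with hα
  have hα0 : 0 < α := by simp only [α]; linarith
  -- The exponent `1 / (2α)` is the rate `|x|^(-2/(p-1))` already known; the minimum with `b` keeps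
  -- `b'` in the range where the power is a supersolution.
  set b' := min b (1 / (2 * α))
  have hb'0 : 0 < b' := lt_min hb (by positivity)
  have hb'b : b' ≤ b := min_le_left _ _
  have hb'α : b' ≤ 1 / (2 * α) := min_le_right _ _
  set κ := min (b * (2 * d - 4 - 4 * b)) (b' * (2 * d - 4 - 4 * b'))
  have hκ : 0 < κ := lt_min (mul_pos hb (by linarith)) (mul_pos hb'0 (by linarith))
  have hs2 : ∀ x : E, 1 ≤ ‖x‖ → 1 + ‖x‖ ^ 2 ≤ 2 * ‖x‖ ^ 2 := fun x hx => by nlinarith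
  -- With this `δ`, and `1 + |x|² ≤ 2|x|²`, the potential satisfies `V (1 + |x|²) ≤ 2 A κ / (4 (A +
  -- 1)) < κ`.
  obtain ⟨R₀, hR₀, h₀⟩ := exists_forall_rpow_mul_norm_le μ hA hp
    (δ := √(κ / (4 * (A + 1)))) (Real.sqrt_pos.2 (by positivity)) hd hu hpos heq hint
  refine exists_forall_le_one_add_norm_sq_rpow hu hpos (V := fun x => A * u x ^ (p - 1))
    (fun x => ?_) hb.le hb'0.le (min_le_left _ _) (min_le_right _ _) (R₀ := R₀) (fun x hx => ?_)
    (fun η hη => ?_)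
  · rw [heq, mul_assoc, Real.rpow_sub_one (hpos x).ne', div_mul_cancel₀ _ (hpos x).ne']
  · have h1 := h₀ x hx
    have h0 : 0 ≤ u x ^ α * ‖x‖ := by have := hpos x; positivity
    have h2 : (u x ^ α * ‖x‖) ^ 2 ≤ κ / (4 * (A + 1)) := by
      rw [← Real.sq_sqrt (by positivity : 0 ≤ κ / (4 * (A + 1)))]
      gcongr
    have h3 : u x ^ (p - 1) = (u x ^ α) ^ 2 := by
      rw [← Real.rpow_natCast, ← Real.rpow_mul (hpos x).le]
      congr 1; simp only [α]; push_cast; ring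
    rw [h3]
    rw [le_div_iff₀ (by positivity)] at h2
    have h4 := hs2 x (hR₀.trans hx)
    have h5 : A * (u x ^ α) ^ 2 * (1 + ‖x‖ ^ 2) ≤ A * (u x ^ α) ^ 2 * (2 * ‖x‖ ^ 2) :=
      mul_le_mul_of_nonneg_left h4 (by positivity)
    have h6 : 0 ≤ (u x ^ α * ‖x‖) ^ 2 := sq_nonneg _
    nlinarith
  · set δ := η ^ α / √2
    have hδ : 0 < δ := by positivity
    obtain ⟨R, hR, h⟩ := exists_forall_rpow_mul_norm_le μ hA hp hδ hd hu hpos heq hint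
    refine ⟨R, fun x hx => ?_⟩
    have hx1 : 1 ≤ ‖x‖ := hR.trans hx
    have h1 := h x hx
    set s := 1 + ‖x‖ ^ 2 with hs
    have hs0 : 0 < s := by positivity
    have hs1 : 1 ≤ s := by rw [hs]; nlinarith [sq_nonneg ‖x‖]
    have h2 : √s ≤ √2 * ‖x‖ := by
      rw [Real.sqrt_le_left (by positivity), mul_pow, Real.sq_sqrt zero_le_two]
      exact hs2 x hx1
    have h3 : u x ^ α * √s ≤ η ^ α := by
      have h4 : u x ^ α * √s ≤ u x ^ α * (√2 * ‖x‖) :=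
        mul_le_mul_of_nonneg_left h2 (by have := hpos x; positivity)
      have h5 : √2 * (u x ^ α * ‖x‖) ≤ √2 * δ := mul_le_mul_of_nonneg_left h1 (by positivity)
      have h6 : √2 * δ = η ^ α := by simp only [δ]; field_simp
      linarith
    have h7 : u x * s ^ (1 / (2 * α)) ≤ η := by
      rw [← Real.rpow_le_rpow_iff (by have := hpos x; positivity) hη.le hα0,
        Real.mul_rpow (hpos x).le (by positivity), ← Real.rpow_mul hs0.le]
      have : 1 / (2 * α) * α = 1 / 2 := by field_simp
      rwa [this, ← Real.sqrt_eq_rpow]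
    have h8 : s ^ b' ≤ s ^ (1 / (2 * α)) := Real.rpow_le_rpow_of_exponent_le hs1 hb'α
    rw [Real.rpow_neg hs0.le, ← div_eq_mul_inv, le_div_iff₀ (by positivity)]
    exact (mul_le_mul_of_nonneg_left h8 (hpos x).le).trans h7

end Decay

/-! ### Energy identity by cutoff -/

section Energy

variable {E : Type*} [NormedAddCommGroup E] [InnerProductSpace ℝ E] [FiniteDimensional ℝ E]
  [MeasurableSpace E] [BorelSpace E] (μ : Measure E) [μ.IsAddHaarMeasure]

open Filter Topology in
/-- The energy identity `∫ |∇ u|² = ∫ u f` for `-Δ u = f`, for `u` decaying fast enough. -/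
theorem integrable_and_integral_norm_gradient_sq {u f : E → ℝ} (hu : ContDiff ℝ 2 u)
    (heq : ∀ x, -(Δ u) x = f x) (huf : Integrable (fun x => u x * f x) μ)
    (hu2 : Integrable (fun x => u x ^ 2 * (1 + ‖x‖ ^ 2)⁻¹) μ) :
    Integrable (fun x => ‖∇ u x‖ ^ 2) μ ∧ ∫ x, ‖∇ u x‖ ^ 2 ∂μ = ∫ x, u x * f x ∂μ := by
  let β : ContDiffBump (0 : E) := ⟨1, 2, one_pos, one_lt_two⟩
  let χ : E → ℝ := β
  have hχ : ContDiff ℝ 2 χ := β.contDiff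
  have hχc : HasCompactSupport χ := β.hasCompactSupport
  set r : ℕ → ℝ := fun k => ((k : ℝ) + 1)⁻¹
  have hr0 : ∀ k, 0 < r k := fun k => by positivity
  have hr1 : ∀ k, r k ≤ 1 := fun k => inv_le_one_of_one_le₀ (by simp)
  have hrlim : Tendsto r atTop (𝓝 0) := by
    simpa [r, one_div] using tendsto_one_div_add_atTop_nhds_zero_nat (𝕜 := ℝ)
  set ψ : ℕ → E → ℝ := fun k x => χ (r k • x)
  have hψ : ∀ k, ContDiff ℝ 2 (ψ k) := fun k => hχ.comp (contDiff_const_smul (r k))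
  have hψc : ∀ k, HasCompactSupport (ψ k) := fun k => hχc.comp_smul (hr0 k).ne'
  have hψ0 : ∀ k x, 0 ≤ ψ k x := fun k x => β.nonneg
  have hψ1 : ∀ k x, ψ k x ≤ 1 := fun k x => β.le_one
  have hψlap : ∀ k x, (Δ (ψ k)) x = r k ^ 2 * (Δ χ) (r k • x) := fun k x => by
    have h := laplacian_comp_add_smul hχ (0 : E) (r k) x
    simpa using h
  have hψone : ∀ (k : ℕ) x, ‖x‖ ≤ k + 1 → ψ k x = 1 := fun k x hx => by
    refine β.one_of_mem_closedBall ?_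
    rw [mem_closedBall_zero_iff, norm_smul, Real.norm_eq_abs, abs_of_pos (hr0 k)]
    exact inv_mul_le_one_of_le₀ hx (by positivity)
  have hψlim : ∀ x, Tendsto (fun k => ψ k x) atTop (𝓝 1) := fun x => by
    refine tendsto_const_nhds.congr' ?_
    obtain ⟨N, hN⟩ := exists_nat_ge ‖x‖
    filter_upwards [eventually_ge_atTop N] with k hk
    have : (N : ℝ) ≤ k := by exact_mod_cast hk
    exact (hψone k x (by linarith)).symm
  obtain ⟨K, hK⟩ := (isCompact_closedBall (0 : E) 2).exists_bound_of_continuousOn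
    hχ.continuous_laplacian.continuousOn
  have hK0 : 0 ≤ K := (norm_nonneg _).trans (hK 0 (by simp))
  have hχlap : ∀ y : E, 2 < ‖y‖ → (Δ χ) y = 0 := fun y hy => by
    have h : χ =ᶠ[𝓝 y] fun _ => 0 := by
      filter_upwards [(isOpen_lt continuous_const continuous_norm).mem_nhds hy] with z hz
      exact β.zero_of_le_dist (by simpa using (le_of_lt hz))
    rw [(laplacian_congr_nhds h).eq_of_nhds]
    simp
  -- The Laplacian of the cutoff vanishes where `r k ‖x‖ > 2`. Elsewhere `r k ^ 2 * (1 + ‖x‖ ^ 2) ≤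
  -- 1 + 4`, so the bound is uniform in `k`, and `hu2` provides the dominating function.
  have hlapbd : ∀ k x, ‖(Δ (ψ k)) x‖ ≤ 5 * K * (1 + ‖x‖ ^ 2)⁻¹ := fun k x => by
    rw [hψlap, norm_mul, Real.norm_eq_abs, abs_of_nonneg (sq_nonneg _)]
    rcases le_or_gt ‖r k • x‖ 2 with h | h
    · have h1 := hK (r k • x) (by simpa using h)
      rw [norm_smul, Real.norm_eq_abs, abs_of_pos (hr0 k)] at h
      rw [← div_eq_mul_inv, le_div_iff₀ (by positivity)]
      have h2 : r k ^ 2 * (1 + ‖x‖ ^ 2) ≤ 5 := by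
        have h3 : (r k * ‖x‖) ^ 2 ≤ 2 ^ 2 := by have := hr0 k; gcongr
        have h4 : r k ^ 2 ≤ 1 := by have := hr0 k; have := hr1 k; nlinarith
        nlinarith
      calc r k ^ 2 * ‖(Δ χ) (r k • x)‖ * (1 + ‖x‖ ^ 2)
          = r k ^ 2 * (1 + ‖x‖ ^ 2) * ‖(Δ χ) (r k • x)‖ := by ring
        _ ≤ 5 * K := by gcongr
    · rw [hχlap _ h, norm_zero, mul_zero]
      positivity
  have hlaplim : ∀ x, Tendsto (fun k => (Δ (ψ k)) x) atTop (𝓝 0) := fun x => by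
    have h1 : Tendsto (fun k => (Δ χ) (r k • x)) atTop (𝓝 ((Δ χ) ((0 : ℝ) • x))) :=
      (hχ.continuous_laplacian.tendsto _).comp (hrlim.smul_const x)
    have h2 := (hrlim.pow 2).mul h1
    simp only [hψlap]
    simpa using h2
  have hu2d : ContDiff ℝ 2 (fun x => u x ^ 2) := hu.pow 2
  have hlap2 : ∀ x, (Δ (fun x => u x ^ 2)) x = 2 * ‖∇ u x‖ ^ 2 - 2 * (u x * f x) := fun x => by
    rw [laplacian_comp (J := fun t => t ^ 2) (J' := fun t => 2 * t) (J'' := fun _ => 2) hu hu2d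
      (fun x => by simpa using hasDerivAt_pow 2 (u x))
      (fun x => by simpa using (hasDerivAt_id (u x)).const_mul 2), ← heq]
    ring
  have hfc : Continuous f := by
    have : f = -(Δ u) := funext fun x => (heq x).symm
    rw [this]
    exact hu.continuous_laplacian.neg
  have hgc : Continuous (fun x => ‖∇ u x‖ ^ 2) :=
    ((hu.of_le (by norm_num)).continuous_gradient.norm).pow 2
  have i1 : ∀ k, Integrable (fun x => ψ k x * ‖∇ u x‖ ^ 2) μ := fun k =>
    ((hψ k).continuous.mul hgc).integrable_of_hasCompactSupport (hψc k).mul_right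
  have i2 : ∀ k, Integrable (fun x => ψ k x * (u x * f x)) μ := fun k =>
    ((hψ k).continuous.mul (hu.continuous.mul hfc)).integrable_of_hasCompactSupport
      (hψc k).mul_right
  -- Testing `Δ(u²) = 2|∇u|² - 2 u f` with the cutoff puts both derivatives on the cutoff, so no
  -- bound on `∇u` is needed.
  have hid : ∀ k, ∫ x, ψ k x * ‖∇ u x‖ ^ 2 ∂μ =
      ∫ x, ψ k x * (u x * f x) ∂μ + (1 / 2) * ∫ x, (Δ (ψ k)) x * u x ^ 2 ∂μ := fun k => by
    rw [integral_mul_laplacian_comm μ (hψ k) hu2d (hψc k)]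
    have e : ∀ x, ψ k x * (Δ (fun x => u x ^ 2)) x =
        2 * (ψ k x * ‖∇ u x‖ ^ 2) - 2 * (ψ k x * (u x * f x)) := fun x => by rw [hlap2]; ring
    simp_rw [e]
    rw [integral_sub ((i1 k).const_mul 2) ((i2 k).const_mul 2), integral_const_mul,
      integral_const_mul]
    ring
  have l1 : Tendsto (fun k => ∫ x, ψ k x * (u x * f x) ∂μ) atTop (𝓝 (∫ x, u x * f x ∂μ)) := by
    refine tendsto_integral_of_dominated_convergence (fun x => ‖u x * f x‖)
      (fun k => (i2 k).aestronglyMeasurable) huf.norm (fun k => Eventually.of_forall fun x => ?_)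
      (Eventually.of_forall fun x => by simpa using (hψlim x).mul_const (u x * f x))
    rw [norm_mul, Real.norm_eq_abs, abs_of_nonneg (hψ0 k x)]
    exact mul_le_of_le_one_left (norm_nonneg _) (hψ1 k x)
  have l2 : Tendsto (fun k => ∫ x, (Δ (ψ k)) x * u x ^ 2 ∂μ) atTop (𝓝 0) := by
    have h := tendsto_integral_of_dominated_convergence (μ := μ)
      (F := fun k x => (Δ (ψ k)) x * u x ^ 2) (f := fun _ => 0)
      (fun x => 5 * K * (u x ^ 2 * (1 + ‖x‖ ^ 2)⁻¹))
      (fun k => ((hψ k).continuous_laplacian.mul hu2d.continuous).aestronglyMeasurable)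
      (hu2.const_mul _) (fun k => Eventually.of_forall fun x => ?_)
      (Eventually.of_forall fun x => by simpa using (hlaplim x).mul_const (u x ^ 2))
    · simpa using h
    · rw [norm_mul, Real.norm_eq_abs (u x ^ 2), abs_of_nonneg (sq_nonneg _)]
      have := mul_le_mul_of_nonneg_right (hlapbd k x) (sq_nonneg (u x))
      linarith
  have l3 : Tendsto (fun k => ∫ x, ψ k x * ‖∇ u x‖ ^ 2 ∂μ) atTop (𝓝 (∫ x, u x * f x ∂μ)) := by
    simp_rw [hid]
    have h := l1.add (l2.const_mul (1 / 2))
    rwa [mul_zero, add_zero] at h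
  have hcover : AECover μ atTop (fun k : ℕ => Metric.closedBall (0 : E) (k + 1)) :=
    aecover_closedBall (tendsto_natCast_atTop_atTop.atTop_add tendsto_const_nhds)
  have hint : Integrable (fun x => ‖∇ u x‖ ^ 2) μ := by
    refine hcover.integrable_of_integral_bounded_of_nonneg_ae (∫ x, u x * f x ∂μ + 1)
      (fun k => hgc.continuousOn.integrableOn_compact (isCompact_closedBall _ _))
      (Eventually.of_forall fun x => by positivity) ?_
    filter_upwards [l3.eventually_le_const (lt_add_one _)] with k hk
    refine le_trans ?_ hk
    rw [← integral_indicator measurableSet_closedBall]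
    refine integral_mono ((integrable_indicator_iff measurableSet_closedBall).2
      (hgc.continuousOn.integrableOn_compact (isCompact_closedBall _ _))) (i1 k) fun x => ?_
    by_cases hx : x ∈ Metric.closedBall (0 : E) (k + 1)
    · rw [Set.indicator_of_mem hx]
      simp only
      rw [hψone k x (by simpa using hx), one_mul]
    · rw [Set.indicator_of_notMem hx]
      exact mul_nonneg (hψ0 k x) (by positivity)
  refine ⟨hint, tendsto_nhds_unique ?_ l3⟩
  refine tendsto_integral_of_dominated_convergence (fun x => ‖∇ u x‖ ^ 2)
    (fun k => (i1 k).aestronglyMeasurable) hint (fun k => Eventually.of_forall fun x => ?_)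
    (Eventually.of_forall fun x => by simpa using (hψlim x).mul_const (‖∇ u x‖ ^ 2))
  rw [norm_mul, Real.norm_eq_abs, abs_of_nonneg (hψ0 k x), Real.norm_eq_abs,
    abs_of_nonneg (sq_nonneg _)]
  exact mul_le_of_le_one_left (sq_nonneg _) (hψ1 k x)

end Energy

/-! ### Weak gradients, integrability and the main theorem -/

theorem isWeakGradient_gradient {n : ℕ} {u : EuclideanSpace ℝ (Fin n) → ℝ} (hu : ContDiff ℝ 1 u) :
    IsWeakGradient u (∇ u) := by
  intro φ hφ hc e
  have hφ1 : ContDiff ℝ 1 φ := hφ.of_le (by exact_mod_cast le_top)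
  have hc' : HasCompactSupport (fun y => fderiv ℝ φ y e) :=
    (hc.fderiv (𝕜 := ℝ)).comp_left (g := fun L : EuclideanSpace ℝ (Fin n) →L[ℝ] ℝ => L e) rfl
  have ue : Continuous (fun y => fderiv ℝ u y e) :=
    (hu.continuous_fderiv (by norm_num)).clm_apply continuous_const
  have φe : Continuous (fun y => fderiv ℝ φ y e) :=
    (hφ1.continuous_fderiv (by norm_num)).clm_apply continuous_const
  simp_rw [inner_gradient_left]
  exact integral_mul_fderiv_eq_neg_fderiv_mul_of_integrable
    ((ue.mul hφ.continuous).integrable_of_hasCompactSupport hc.mul_left)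
    ((hu.continuous.mul φe).integrable_of_hasCompactSupport hc'.mul_left)
    ((hu.continuous.mul hφ.continuous).integrable_of_hasCompactSupport hc.mul_left)
    (fun x _ => (hu.differentiable (by norm_num)).differentiableAt)
    (fun x _ => (hφ1.differentiable (by norm_num)).differentiableAt)

theorem integrable_rpow_of_le_one_add_norm_sq_rpow {E : Type*} [NormedAddCommGroup E]
    [NormedSpace ℝ E] [FiniteDimensional ℝ E] [MeasurableSpace E] [BorelSpace E] (μ : Measure E)
    [μ.IsAddHaarMeasure] {u : E → ℝ} (hu : Continuous u) (hpos : ∀ x, 0 < u x) {C b s t : ℝ}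
    (hC : 0 ≤ C) (hs : 0 ≤ s) (hle : ∀ x, u x ≤ C * (1 + ‖x‖ ^ 2) ^ (-b))
    (hst : (Module.finrank ℝ E : ℝ) < 2 * b * s + 2 * t) :
    Integrable (fun x => u x ^ s * (1 + ‖x‖ ^ 2) ^ (-t)) μ := by
  refine ((integrable_rpow_neg_one_add_norm_sq (μ := μ) hst).const_mul (C ^ s)).mono' ?_
    (Filter.Eventually.of_forall fun x => ?_)
  · refine Continuous.aestronglyMeasurable ?_
    exact (hu.rpow_const fun y => Or.inl (hpos y).ne').mul
      (Continuous.rpow_const (by fun_prop) fun y => Or.inl (by positivity))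
  · have hx := hpos x
    have h0 : 0 < 1 + ‖x‖ ^ 2 := by positivity
    rw [Real.norm_eq_abs, abs_of_nonneg (by positivity)]
    have h1 : u x ^ s ≤ (C * (1 + ‖x‖ ^ 2) ^ (-b)) ^ s := Real.rpow_le_rpow hx.le (hle x) hs
    rw [Real.mul_rpow hC (by positivity), ← Real.rpow_mul h0.le] at h1
    have h2 : (1 + ‖x‖ ^ 2) ^ (-(2 * b * s + 2 * t) / 2) =
        (1 + ‖x‖ ^ 2) ^ (-b * s) * (1 + ‖x‖ ^ 2) ^ (-t) := by
      rw [← Real.rpow_add h0]; congr 1; ring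
    rw [h2, ← mul_assoc]
    exact mul_le_mul_of_nonneg_right h1 (by positivity)

/-- The two components of a solution agree if both have infimum zero. -/
theorem IsClassicalSolution.eq {n : ℕ} {p : ℝ} {u v : EuclideanSpace ℝ (Fin n) → ℝ}
    (h : IsClassicalSolution n p u v) (hui : ∀ ε : ℝ, 0 < ε → ∃ x, u x < ε)
    (hvi : ∀ ε : ℝ, 0 < ε → ∃ x, v x < ε) : u = v := by
  have hu0 := h.pos_u
  have hv0 := h.pos_v
  refine eq_of_laplacian_sub_eq_mul h.contDiff_u h.contDiff_v (c := fun x => √p * u x ^ (p - 1))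
    (fun x => ?_) (fun x => ?_) (fun x => (hu0 x).le) (fun x => (hv0 x).le) hui hvi
    (fun x => ?_) fun x => ?_
  · have := h.eq_u x; have := hu0 x; have := hv0 x
    have : 0 ≤ √p * u x ^ (p - 1) * v x := by positivity
    linarith
  · have := h.eq_v x; have := hu0 x
    have : 0 ≤ √p * u x ^ p := by positivity
    linarith
  · have := hu0 x; positivity
  · have e : u x ^ p = u x ^ (p - 1) * u x := by
      rw [Real.rpow_sub_one (hu0 x).ne', div_mul_cancel₀ _ (hu0 x).ne']
    have h1 := h.eq_u x
    have h2 := h.eq_v x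
    rw [e] at h2
    linear_combination h1 - h2

theorem theorem3p2 (n : ℕ) (hn : 3 ≤ n) (p : ℝ) (hp : 1 < p)
    (u v : EuclideanSpace ℝ (Fin n) → ℝ)
    (huv : IsClassicalSolution n p u v)
    (hv : ∀ ε : ℝ, 0 < ε → ∃ x, v x < ε)
    (hu : MemLp u (ENNReal.ofReal ((n : ℝ) * (p - 1) / 2)) volume) :
    Integrable (fun x => u x ^ p * v x) volume ∧
      MemHomSobolev u ∧
      Integrable (fun x => ‖∇ u x‖ ^ 2) volume ∧
      Integrable (fun x => ‖∇ v x‖ ^ 2) volume ∧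
      ∫ x, ‖∇ u x‖ ^ 2 = ∫ x, ‖∇ v x‖ ^ 2 ∧
      ∫ x, ‖∇ v x‖ ^ 2 = √p * ∫ x, u x ^ p * v x := by
  have hn3 : (3 : ℝ) ≤ n := by exact_mod_cast hn
  have hp0 : 0 < p - 1 := by linarith
  set q : ℝ := n * (p - 1) / 2 with hq
  have hq0 : 0 < q := by positivity
  have : Nontrivial (EuclideanSpace ℝ (Fin n)) :=
    Module.nontrivial_of_finrank_pos (R := ℝ) (by rw [finrank_euclideanSpace_fin]; omega)
  have hq' : ENNReal.ofReal q ≠ 0 := by simpa using hq0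
  obtain rfl : u = v :=
    huv.eq (fun ε hε => exists_lt_of_memLp volume hq' ENNReal.ofReal_ne_top hu hε) hv
  have hpos := huv.pos_u
  have hC2 := huv.contDiff_u
  have huq : Integrable (fun x => u x ^ q) := by
    have h := hu.integrable_norm_rpow hq' ENNReal.ofReal_ne_top
    rw [ENNReal.toReal_ofReal hq0.le] at h
    simpa only [Real.norm_eq_abs, abs_of_pos (hpos _)] using h
  -- `2b = 3(n-2)/4` lies strictly between `(n-2)/2`, the threshold for `u^(2n/(n-2))` and `u² / (1
  -- + |x|²)`, and `n - 2`, the limit of the comparison.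
  obtain ⟨C, hC, hdec⟩ := exists_forall_le_one_add_norm_sq_rpow_of_integrable volume
    (A := √p) (b := 3 / 8 * (n - 2)) (Real.sqrt_nonneg p) hp hC2 hpos huv.eq_v
    (by rwa [finrank_euclideanSpace_fin]) (by linarith)
    (by rw [finrank_euclideanSpace_fin]; linarith)
  have hpow : ∀ {s t : ℝ}, 0 ≤ s → (n : ℝ) < 2 * (3 / 8 * (n - 2)) * s + 2 * t →
      Integrable (fun x => u x ^ s * (1 + ‖x‖ ^ 2) ^ (-t)) := fun hs h =>
    integrable_rpow_of_le_one_add_norm_sq_rpow volume hC2.continuous hpos hC hs hdec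
      (by rwa [finrank_euclideanSpace_fin])
  have hup : ∀ x, u x ^ p * u x = u x ^ (p + 1) := fun x => by
    rw [Real.rpow_add_one (hpos x).ne']
  have hint : Integrable (fun x => u x ^ (p + 1)) := by
    -- If `q ≤ p + 1`, boundedness of `u` reduces the claim to `u ^ q`. Otherwise `n(p-1) > 2(p+1)`,
    -- that is `(n-2)(p+1) > 2n`, and the decay gives `u^(p+1)` the order `3(n-2)(p+1)/4 > 3n/2 >
    -- n`.
    rcases le_or_gt q (p + 1) with h | h
    · refine (huq.const_mul (C ^ (p + 1 - q))).mono' ?_ (Filter.Eventually.of_forall fun x => ?_)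
      · exact (hC2.continuous.rpow_const fun y => Or.inl (hpos y).ne').aestronglyMeasurable
      · have hx := hpos x
        have hxC : u x ≤ C := (hdec x).trans (mul_le_of_le_one_right hC
          (Real.rpow_le_one_of_one_le_of_nonpos (by nlinarith [sq_nonneg ‖x‖]) (by linarith)))
        rw [Real.norm_eq_abs, abs_of_pos (by positivity),
          show p + 1 = (p + 1 - q) + q by ring, Real.rpow_add hx, add_sub_cancel_right]
        exact mul_le_mul_of_nonneg_right (Real.rpow_le_rpow hx.le hxC (by linarith)) (by positivity)
    · have := hpow (s := p + 1) (t := 0) (by linarith) (by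
        rw [hq] at h
        nlinarith)
      simpa using this
  have hint' : Integrable (fun x => u x ^ p * u x) := by simpa only [hup] using hint
  have hmul : ∀ x, u x * (√p * u x ^ p) = √p * (u x ^ p * u x) := fun x => by ring
  obtain ⟨hg, hgeq⟩ := integrable_and_integral_norm_gradient_sq volume hC2 huv.eq_v
    (by simpa only [hmul] using hint'.const_mul √p)
    (by
      have h := hpow (s := 2) (t := 1) (by norm_num) (by linarith)
      simpa only [Real.rpow_two, Real.rpow_neg_one] using h)
  simp_rw [hmul, integral_const_mul] at hgeq
  have hgc : Continuous (∇ u) := (hC2.of_le (by norm_num)).continuous_gradient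
  refine ⟨hint', ⟨?_, ∇ u, ?_, isWeakGradient_gradient (hC2.of_le (by norm_num))⟩, hg, hg, rfl, hgeq⟩
  · have hs0 : 0 < 2 * (n : ℝ) / (n - 2) := div_pos (by linarith) (by linarith)
    rw [← integrable_norm_rpow_iff hC2.continuous.aestronglyMeasurable (by simpa using hs0)
      ENNReal.ofReal_ne_top, ENNReal.toReal_ofReal hs0.le]
    have h := hpow (s := 2 * (n : ℝ) / (n - 2)) (t := 0) hs0.le (by
      have : (n : ℝ) - 2 ≠ 0 := by linarith
      have e : 2 * (3 / 8 * ((n : ℝ) - 2)) * (2 * n / (n - 2)) + 2 * 0 = 3 / 2 * n := by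
        field_simp
        ring
      rw [e]
      linarith)
    simpa only [Real.norm_eq_abs, abs_of_pos (hpos _), neg_zero, Real.rpow_zero, mul_one] using h
  · exact (memLp_two_iff_integrable_sq_norm hgc.aestronglyMeasurable).2 hg
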